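/- Let $n\ge 1$, let $\mathbb{B}_n$ and $\mathbb{S}_n$ be the open unit ball and the unit sphere of $\mathbb{C}^n$, let $\sigma$ be the normalized surface measure on $\mathbb{S}_n$, and write $\langle z,w\rangle=\sum_k z_k\overline{w_k}$. For $\varphi\in L^1(\mathbb{S}_n)$ let $$u_\varphi(z)=\int_{\mathbb{S}_n}\varphi(\zeta)\,\frac{(1-|z|^2)^n}{|1-\langle z,\zeta\rangle|^{2n}}\,d\sigma(\zeta),\qquad z\in\mathbb{B}_n,$$ be its invariant Poisson integral. For $\alpha>1$ and $\zeta\in\mathbb{S}_n$ let $\Gamma_\alpha(\zeta)=\{z\in\mathbb{B}_n: |1-\langle z,\zeta\rangle|<\tfrac{\alpha}{2}(1-|z|^2)\}$, and for a finite positive Borel measure $\mu$ on $\mathbb{B}_n$ put $$\widetilde\mu(\zeta)=\int_{\Gamma_\alpha(\zeta)}(1-|z|^2)^{-n}\,d\mu(z),\qquad \zeta\in\mathbb{S}_n.$$ Let $1<p<\infty$, $0<s<p$, $\alpha>1$, and for such $\mu$ let $K_\mu\in[0,\infty]$ be the smallest constant for which $$\int_{\mathbb{B}_n}|u_\varphi(z)|^s\,d\mu(z)\le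 K_\mu\,\|\varphi\|_{L^p(\mathbb{S}_n)}^s\qquad\text{for all complex-valued }\varphi\in L^p(\mathbb{S}_n).$$ **Theorem.** (i) For every finite positive Borel measure $\mu$ on $\mathbb{B}_n$, this inequality holds with some finite constant if and only if $\widetilde\mu\in L^{p/(p-s)}(\mathbb{S}_n)$. (ii) $K_\mu$ and $\|\widetilde\mu\|_{L^{p/(p-s)}(\mathbb{S}_n)}$ are comparable, in the following sense. There is a constant $C=C(n,p,s,\alpha)$ such that $\|\widetilde\mu\|_{L^{p/(p-s)}(\mathbb{S}_n)}\le C\,K_\mu$ for every finite positive Borel measure $\mu$ on $\mathbb{B}_n$. Conversely, for every real $\rho>\frac{2}{\alpha}-1$ there is a constant $C=C(n,p,s,\alpha,\rho)$ such that $K_\mu\le C\,\|\widetilde\mu\|_{L^{p/(p-s)}(\mathbb{S}_n)}$ for every finite positive Borel measure $\mu$ on $\mathbb{B}_n$ with $\mu(\{z:|z|<\rho\})=0$. If $\alpha>2$ one may take $\rho=0$, so that then $K_\mu\asymp\|\widetilde\mu\|_{L^{p/(p-s)}(\mathbb{S}_n)}$ for all finite positive Borel measures $\mu$ on $\mathbb{B}_n$,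 with constants depending only on $n,p,s,\alpha$. -/

import Mathlib

open MeasureTheory
open scoped ENNReal NNReal

noncomputable section

/-- Complex Euclidean space `ℂⁿ` with its Hermitian norm. -/
abbrev CSpace (n : ℕ) : Type := EuclideanSpace ℂ (Fin n)

/-- The open unit ball `𝔹ₙ` of `ℂⁿ`. -/
abbrev UBall (n : ℕ) : Type := Metric.ball (0 : CSpace n) 1

/-- The unit sphere `𝕊ₙ` of `ℂⁿ`. -/
abbrev USphere (n : ℕ) : Type := Metric.sphere (0 : CSpace n) 1

/-- The normalized surface measure `σ` on the unit sphere (total mass one). -/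
def sphereMeasure (n : ℕ) : Measure (USphere n) :=
  ((volume : Measure (CSpace n)).toSphere Set.univ)⁻¹ • (volume : Measure (CSpace n)).toSphere

/-- The Hermitian product `⟨z, w⟩ = ∑ zᵢ * conj wᵢ`, linear in `z`. Mathlib's `inner ℂ` is linear
in its second argument, hence the order of the arguments. -/
def herm {n : ℕ} (z w : CSpace n) : ℂ := inner ℂ w z

/-- The invariant Poisson kernel `(1 - |z|²)ⁿ / |1 - ⟨z, ζ⟩|²ⁿ`. -/
def invPoissonKernel {n : ℕ} (z : UBall n) (ζ : USphere n) : ℝ :=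
  (1 - ‖(z : CSpace n)‖ ^ 2) ^ n / ‖1 - herm (z : CSpace n) (ζ : CSpace n)‖ ^ (2 * n)

/-- The invariant Poisson integral `u_φ` of a function `φ` on the sphere. -/
def invPoissonIntegral {n : ℕ} (φ : USphere n → ℂ) (z : UBall n) : ℂ :=
  ∫ ζ, (invPoissonKernel z ζ : ℂ) * φ ζ ∂(sphereMeasure n)

/-- The admissible approach region `Γ_α(ζ)` of aperture `α`. -/
def admissibleRegion {n : ℕ} (α : ℝ) (ζ : USphere n) : Set (UBall n) :=
  {z | ‖1 - herm (z : CSpace n) (ζ : CSpace n)‖ < α / 2 * (1 - ‖(z : CSpace n)‖ ^ 2)}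

/-- The function `μ̃(ζ) = ∫_{Γ_α(ζ)} (1 - |z|²)⁻ⁿ dμ(z)`, with values in `[0, ∞]`. -/
def tildeMu {n : ℕ} (α : ℝ) (μ : Measure (UBall n)) (ζ : USphere n) : ℝ≥0∞ :=
  ∫⁻ z in admissibleRegion α ζ, ENNReal.ofReal (((1 - ‖(z : CSpace n)‖ ^ 2) ^ n)⁻¹) ∂μ

/-- `K` is an admissible constant in the Poisson embedding inequality:
`∫ |u_φ|^s dμ ≤ K ‖φ‖_{L^p}^s` for every `φ ∈ L^p(𝕊ₙ)`. -/
def PoissonEmbeddingBound {n : ℕ} (p s : ℝ) (μ : Measure (UBall n)) (K : ℝ≥0∞) : Prop :=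
  ∀ φ : USphere n → ℂ, MemLp φ (ENNReal.ofReal p) (sphereMeasure n) →
    ∫⁻ z, ‖invPoissonIntegral φ z‖ₑ ^ s ∂μ
      ≤ K * eLpNorm φ (ENNReal.ofReal p) (sphereMeasure n) ^ s

/-- The best constant `K_μ ∈ [0, ∞]` in the Poisson embedding inequality. -/
def poissonEmbeddingConst {n : ℕ} (p s : ℝ) (μ : Measure (UBall n)) : ℝ≥0∞ :=
  sInf {K : ℝ≥0∞ | PoissonEmbeddingBound p s μ K}

end

/-! Write Q(z) for the shadow of z, the set of ζ with z ∈ Γ_α(ζ), and δ = 1 - |z|². By Fubini, ∫ G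
μ̃ dσ = ∫ δ⁻ⁿ ∫_{Q(z)} G dσ dμ(z) (`lintegral_mul_tildeMu`), so both directions compare |u_φ(z)|^s
with averages over shadows. The tool is the maximal operator M over Korányi balls, bounded on L^r
for every r > 1 (`exists_koranyiMaximal_strong_type`).

Sufficiency: at every ζ ∈ Q(z), |u_φ(z)| ≤ C M|φ|(ζ) (`exists_lPoisson_le_koranyiMaximal`). If
σ(Q(z)) ≥ c δⁿ, averaging over Q(z) and Fubini give ∫ |u_φ|^s dμ ≤ C ∫ (M|φ|)^s μ̃ dσ. Hölder with
exponents p/s and p/(p-s) and the maximal theorem in L^p finish. The shadow is empty when |z| ≤ 2/α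
- 1, and large as soon as |z| ≥ ρ > 2/α - 1 (`exists_le_sphereMeasure_shadow`). Hence the condition
on ρ. The mass of μ near the origin is invisible to μ̃, but there the kernel is bounded, which is
enough for (i).

Necessity: by duality it suffices to bound ∫ ψ μ̃ dσ for ψ ≥ 0 in L^{p/s}. The average of ψ over
Q(z) is at most C Mψ throughout an enlarged shadow, where the Poisson kernel is at least c δ⁻ⁿ. So
it is at most C (P[(Mψ)^{1/s}](z))^s (`exists_shadow_average_le_lPoisson`). The embedding tested on
(Mψ)^{1/s}, and the maximal theorem in L^{p/s}, where p/s > 1, give ∫ ψ μ̃ dσ ≤ C K ‖ψ‖_{p/s}. -/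

open scoped Pointwise

/-! ### The Korányi quasi-distance -/

theorem norm_one_sub_herm_comm {n : ℕ} (a b : CSpace n) :
    ‖1 - herm a b‖ = ‖1 - herm b a‖ := by
  have h : 1 - herm a b = (starRingEnd ℂ) (1 - herm b a) := by
    simp [herm]
  rw [h, RCLike.norm_conj]

theorem norm_sub_sq_le_herm {n : ℕ} {a b : CSpace n} (ha : ‖a‖ ≤ 1) (hb : ‖b‖ ≤ 1) :
    ‖a - b‖ ^ 2 ≤ 2 * ‖1 - herm a b‖ := by
  have h1 := @norm_sub_sq ℂ _ _ _ _ a b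
  have h2 : (1 - herm a b).re ≤ ‖1 - herm a b‖ := Complex.re_le_norm _
  have h3 : (herm a b).re = RCLike.re (inner ℂ a b) := by
    rw [inner_re_symm]; rfl
  rw [Complex.sub_re, h3, Complex.one_re] at h2
  nlinarith [norm_nonneg a, norm_nonneg b]

theorem one_sub_norm_le_herm {n : ℕ} {a b : CSpace n} (hb : ‖b‖ ≤ 1) :
    1 - ‖a‖ ≤ ‖1 - herm a b‖ := by
  have h1 : ‖herm a b‖ ≤ ‖b‖ * ‖a‖ := norm_inner_le_norm _ _
  have h2 : ‖(1 : ℂ)‖ - ‖herm a b‖ ≤ ‖1 - herm a b‖ := norm_sub_norm_le _ _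
  rw [norm_one] at h2
  nlinarith [norm_nonneg a, norm_nonneg b]

/-- The quasi-triangle inequality for the Korányi quasi-distance `|1 - ⟨a, b⟩|`. -/
theorem norm_one_sub_herm_triangle {n : ℕ} {a b c : CSpace n} (ha : ‖a‖ ≤ 1) (hb : ‖b‖ ≤ 1)
    (hc : ‖c‖ ≤ 1) :
    ‖1 - herm a c‖ ≤ 4 * (‖1 - herm a b‖ + ‖1 - herm b c‖) := by
  -- The cross term is at most |a - b||b - c|, hence at most half the sum of the squares, and
  -- `norm_sub_sq_le_herm` bounds each square. The correction 1 - |b|² is at most 2(1 - |b|) ≤ 2|1 -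
  -- ⟨b, c⟩|.
  have key : 1 - herm a c =
      (1 - herm a b) + herm (a - b) (b - c) - ((1 : ℂ) - herm b b) + (1 - herm b c) := by
    simp only [herm, inner_sub_left, inner_sub_right]; ring
  have h1 : ‖herm (a - b) (b - c)‖ ≤ ‖b - c‖ * ‖a - b‖ := norm_inner_le_norm _ _
  have h2 := norm_sub_sq_le_herm ha hb
  have h3 := norm_sub_sq_le_herm hb hc
  have h4 : ‖(1 : ℂ) - herm b b‖ ≤ 2 * ‖1 - herm b c‖ := by
    have h5 := one_sub_norm_le_herm (a := b) hc
    have h6 : (1 : ℂ) - herm b b = ((1 - ‖b‖ ^ 2 : ℝ) : ℂ) := by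
      simp [herm, inner_self_eq_norm_sq_to_K]
    rw [h6, Complex.norm_real, Real.norm_of_nonneg] <;> nlinarith [norm_nonneg b]
  have h7 : ‖1 - herm a c‖ ≤ ‖1 - herm a b‖ + ‖herm (a - b) (b - c)‖ + ‖(1 : ℂ) - herm b b‖
      + ‖1 - herm b c‖ := by
    rw [key]
    refine (norm_add_le _ _).trans (add_le_add ((norm_sub_le _ _).trans
      (add_le_add (norm_add_le _ _) le_rfl)) le_rfl)
  nlinarith [sq_nonneg (‖b - c‖ - ‖a - b‖)]

/-! ### Korányi balls of radius t have measure comparable to tⁿ -/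

/-- The Korányi ball of centre `ζ` and radius `t` on the sphere. -/
def koranyiBall {n : ℕ} (ζ : CSpace n) (t : ℝ) : Set (USphere n) :=
  {η | ‖1 - herm ζ (η : CSpace n)‖ < t}

theorem isOpen_koranyiBall {n : ℕ} (ζ : CSpace n) (t : ℝ) : IsOpen (koranyiBall ζ t) := by
  have h : Continuous fun η : USphere n => ‖1 - herm ζ (η : CSpace n)‖ := by
    unfold herm; fun_prop
  exact isOpen_lt h continuous_const

theorem koranyiBall_mono {n : ℕ} (ζ : CSpace n) {t t' : ℝ} (h : t ≤ t') :
    koranyiBall ζ t ⊆ koranyiBall ζ t' :=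
  Set.ofPred_subset_ofPred.2 fun _ hη => hη.trans_le h

theorem mem_koranyiBall_self {n : ℕ} (ζ : USphere n) {t : ℝ} (ht : 0 < t) :
    ζ ∈ koranyiBall (ζ : CSpace n) t := by
  have h : ‖(ζ : CSpace n)‖ = 1 := by simp
  have : herm (ζ : CSpace n) ζ = 1 := by simp [herm, inner_self_eq_norm_sq_to_K, h]
  simp [koranyiBall, this, ht]

/-- The coordinate box with one long real, one real of size `t` and `n - 1` complex coordinates of
size `r`. -/
def koranyiBox (m : ℕ) (a b t r : ℝ) : Set (Fin (m + 1) → ℂ) :=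
  Set.univ.pi (Fin.cons (Set.Ioo a b ×ℂ Set.Ioo (-t) t) fun _ => Metric.ball 0 r)

theorem volume_reProdIm (s t : Set ℝ) :
    volume (s ×ℂ t) = volume s * volume t := by
  have : s ×ℂ t = Complex.measurableEquivRealProd ⁻¹' (s ×ˢ t) := by
    ext z; simp [Complex.mem_reProdIm]
  rw [this, Complex.volume_preserving_equiv_real_prod.measure_preimage_equiv,
    Measure.volume_eq_prod, Measure.prod_prod]

theorem volume_koranyiBox (m : ℕ) (a b t r : ℝ) :
    volume (koranyiBox m a b t r) =
      ENNReal.ofReal (b - a) * ENNReal.ofReal (2 * t) * (ENNReal.ofReal r ^ 2 * NNReal.pi) ^ m := by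
  rw [koranyiBox, volume_pi_pi, Fin.prod_univ_succ]
  simp [volume_reProdIm, Complex.volume_ball, two_mul]

/-- Uniqueness of Haar measure gives κ for one basis. Two orthonormal bases differ by an isometry,
so κ does not depend on the basis, which makes the ball estimates uniform in the centre. -/
theorem exists_volume_coordinates_eq (n : ℕ) : ∃ κ : ℝ≥0∞, κ ≠ 0 ∧ κ ≠ ∞ ∧
    ∀ (b : OrthonormalBasis (Fin n) ℂ (CSpace n)) (s : Set (Fin n → ℂ)), MeasurableSet s →
      volume ((fun x : CSpace n => fun i => inner ℂ (b i) x) ⁻¹' s) = κ * volume s := by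
  let e : CSpace n ≃L[ℝ] (Fin n → ℂ) := (PiLp.continuousLinearEquiv 2 ℝ fun _ : Fin n => ℂ)
  have : Measure.IsAddHaarMeasure (Measure.map e volume) :=
    ContinuousLinearEquiv.isAddHaarMeasure_map e volume
  have h := Measure.isAddLeftInvariant_eq_smul (Measure.map e volume)
    (volume : Measure (Fin n → ℂ))
  have h0 := Measure.addHaarScalarFactor_pos_of_isAddHaarMeasure (Measure.map e volume)
    (volume : Measure (Fin n → ℂ))
  refine ⟨_, ENNReal.coe_ne_zero.2 h0.ne', ENNReal.coe_ne_top, fun b s hs => ?_⟩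
  let r : CSpace n ≃ₗᵢ[ℝ] CSpace n :=
    { b.repr.toLinearEquiv.restrictScalars ℝ with norm_map' := b.repr.norm_map }
  have h2 : (fun x : CSpace n => fun i => inner ℂ (b i) x) ⁻¹' s = r ⁻¹' (e ⁻¹' s) := by
    ext x
    have : (fun i => inner ℂ (b i) x) = e (r x) := by
      ext i
      exact (b.repr_apply_apply x i).symm
    simp only [Set.mem_preimage, this]
  rw [h2, r.measurePreserving.measure_preimage
    (e.continuous.measurable hs).nullMeasurableSet,
    ← Measure.map_apply e.continuous.measurable hs]
  conv_lhs => rw [h]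
  rfl

theorem exists_orthonormalBasis_zero_eq {m : ℕ} (ζ : USphere (m + 1)) :
    ∃ b : OrthonormalBasis (Fin (m + 1)) ℂ (CSpace (m + 1)), b 0 = ζ := by
  obtain ⟨b, hb⟩ := Orthonormal.exists_orthonormalBasis_extension_of_card_eq (𝕜 := ℂ)
    (E := CSpace (m + 1)) (ι := Fin (m + 1)) (by simp) (v := fun _ => (ζ : CSpace (m + 1)))
    (s := {0}) (by
      refine ⟨fun i => by simp, fun i j hij => ?_⟩
      exact absurd (Subtype.ext (i.2.trans j.2.symm)) hij)
  exact ⟨b, hb 0 rfl⟩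

/-- Surface measure is, up to a constant, the volume of the cone over the set; ball estimates
thereby become volume estimates for coordinate boxes. -/
theorem exists_sphereMeasure_apply_eq {n : ℕ} (hn : 1 ≤ n) : ∃ c : ℝ≥0∞, c ≠ 0 ∧ c ≠ ∞ ∧
    ∀ s : Set (USphere n), MeasurableSet s →
      sphereMeasure n s = c * volume (Set.Ioo (0 : ℝ) 1 • (Subtype.val '' s)) := by
  have : Nonempty (Fin n) := ⟨⟨0, hn⟩⟩
  have h0 : (volume : Measure (CSpace n)).toSphere Set.univ ≠ 0 := by
    rw [Measure.measure_univ_ne_zero]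
    exact Measure.toSphere_ne_zero _
  refine ⟨((volume : Measure (CSpace n)).toSphere Set.univ)⁻¹ * (Module.finrank ℝ (CSpace n) : ℕ),
    mul_ne_zero (ENNReal.inv_ne_zero.2 (measure_ne_top _ _)) ?_,
    ENNReal.mul_ne_top (ENNReal.inv_ne_top.2 h0) (ENNReal.natCast_ne_top _), fun s hs => ?_⟩
  · exact_mod_cast (Module.finrank_pos (R := ℝ) (M := CSpace n)).ne'
  · rw [sphereMeasure, Measure.smul_apply, Measure.toSphere_apply' _ hs, smul_eq_mul, mul_assoc]

theorem isProbabilityMeasure_sphereMeasure {n : ℕ} (hn : 1 ≤ n) :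
    IsProbabilityMeasure (sphereMeasure n) := by
  have : Nonempty (Fin n) := ⟨⟨0, hn⟩⟩
  have h0 : (volume : Measure (CSpace n)).toSphere Set.univ ≠ 0 := by
    rw [Measure.measure_univ_ne_zero]
    exact Measure.toSphere_ne_zero _
  exact ⟨by rw [sphereMeasure, Measure.smul_apply, smul_eq_mul,
    ENNReal.inv_mul_cancel h0 (measure_ne_top _ _)]⟩

instance (n : ℕ) : SFinite (sphereMeasure n) := by
  unfold sphereMeasure; infer_instance

theorem measurableSet_koranyiBox (m : ℕ) (a b t r : ℝ) :
    MeasurableSet (koranyiBox m a b t r) := by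
  refine MeasurableSet.univ_pi fun i => ?_
  refine Fin.cases ?_ (fun j => ?_) i
  · exact (Complex.measurable_re measurableSet_Ioo).inter (Complex.measurable_im measurableSet_Ioo)
  · exact Metric.isOpen_ball.measurableSet

theorem mem_koranyiBox {m : ℕ} {a b t r : ℝ} {x : Fin (m + 1) → ℂ} :
    x ∈ koranyiBox m a b t r ↔
      ((a < (x 0).re ∧ (x 0).re < b) ∧ (-t < (x 0).im ∧ (x 0).im < t)) ∧
        ∀ j : Fin m, ‖x j.succ‖ < r := by
  simp [koranyiBox, Set.mem_pi, Fin.forall_fin_succ, Complex.mem_reProdIm]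

/-- With w = ⟨ω, ζ⟩ within t of 1, the imaginary part of w is below t and the tangential coordinates
have square sum 1 - |w|² < 2t. Scaling by a factor in (0, 1) only shrinks these. The box has volume
of order t · tᵐ. -/
theorem cone_koranyiBall_subset {m : ℕ} (ζ : USphere (m + 1))
    (b : OrthonormalBasis (Fin (m + 1)) ℂ (CSpace (m + 1))) (hb : b 0 = ζ) {t : ℝ} :
    Set.Ioo (0 : ℝ) 1 • (Subtype.val '' koranyiBall (ζ : CSpace (m + 1)) t) ⊆
      (fun x : CSpace (m + 1) => fun i => inner ℂ (b i) x) ⁻¹'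
        koranyiBox m (-2) 2 t (√(2 * t)) := by
  rintro _ ⟨ρ, ⟨hρ0, hρ1⟩, _, ⟨ω, hω, rfl⟩, rfl⟩
  have hω' : ‖1 - herm (ω : CSpace (m + 1)) ζ‖ < t := by
    rw [norm_one_sub_herm_comm]; exact hω
  set w : ℂ := herm (ω : CSpace (m + 1)) ζ with hw
  have hn1 : ‖(ω : CSpace (m + 1))‖ = 1 := by simp
  have hsum := b.sum_sq_norm_inner_right (ω : CSpace (m + 1))
  rw [Fin.sum_univ_succ, hn1, hb] at hsum
  have hw1 : ‖w‖ ≤ 1 := by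
    have : ‖w‖ ≤ ‖(ζ : CSpace (m + 1))‖ * ‖(ω : CSpace (m + 1))‖ := norm_inner_le_norm _ _
    simpa using this
  have hre := (Complex.abs_re_le_norm w).trans hw1
  have him : |w.im| < t := by
    have := Complex.abs_im_le_norm (1 - w)
    rw [Complex.sub_im, Complex.one_im, zero_sub, abs_neg] at this
    linarith
  have hwn : 1 - ‖w‖ < t := by
    have := norm_sub_norm_le (1 : ℂ) w
    rw [norm_one] at this
    linarith
  rw [abs_le] at hre
  rw [abs_lt] at him
  have hx : ∀ i, inner ℂ (b i) (ρ • (ω : CSpace (m + 1))) = (ρ : ℂ) * inner ℂ (b i) ω.1 := by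
    intro i
    rw [← Complex.coe_smul, inner_smul_right]
  have h0 : inner ℂ (b 0) (ρ • (ω : CSpace (m + 1))) = (ρ : ℂ) * w := by
    rw [hx, hb]; rfl
  refine mem_koranyiBox.2 ⟨⟨⟨?_, ?_⟩, ?_, ?_⟩, fun j => ?_⟩
  · change _ < (inner ℂ (b 0) (ρ • (ω : CSpace (m + 1)))).re
    rw [h0, Complex.re_ofReal_mul]; nlinarith
  · change (inner ℂ (b 0) (ρ • (ω : CSpace (m + 1)))).re < _
    rw [h0, Complex.re_ofReal_mul]; nlinarith
  · change _ < (inner ℂ (b 0) (ρ • (ω : CSpace (m + 1)))).im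
    rw [h0, Complex.im_ofReal_mul]; nlinarith
  · change (inner ℂ (b 0) (ρ • (ω : CSpace (m + 1)))).im < _
    rw [h0, Complex.im_ofReal_mul]; nlinarith
  · change ‖inner ℂ (b j.succ) (ρ • (ω : CSpace (m + 1)))‖ < _
    have hj : ‖inner ℂ (b j.succ) ω.1‖ ^ 2 < 2 * t := by
      have h1 : ‖inner ℂ (b j.succ) ω.1‖ ^ 2 ≤ ∑ i : Fin m, ‖inner ℂ (b i.succ) ω.1‖ ^ 2 :=
        Finset.single_le_sum (f := fun i : Fin m => ‖inner ℂ (b i.succ) ω.1‖ ^ 2)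
          (fun _ _ => sq_nonneg _) (Finset.mem_univ j)
      have h2 : ‖inner ℂ ζ.1 ω.1‖ = ‖w‖ := rfl
      rw [h2] at hsum
      nlinarith [norm_nonneg w]
    rw [hx, norm_mul, Complex.norm_real, Real.norm_of_nonneg hρ0.le]
    have := Real.lt_sqrt_of_sq_lt hj
    nlinarith [norm_nonneg (inner ℂ (b j.succ) ω.1)]

/-- Radial projection of the box lands in the ball. Let R = |x| and w = ⟨x, ζ⟩. The first coordinate
keeps R between 1/4 and 1. The tangential radius makes the other coordinates contribute at most t/64
to R², so R - Re w ≤ t/16, and |R - w| < t/16 + t/32 < tR. -/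
theorem koranyiBox_subset_cone {m : ℕ} (ζ : USphere (m + 1))
    (b : OrthonormalBasis (Fin (m + 1)) ℂ (CSpace (m + 1))) (hb : b 0 = ζ) {t : ℝ} (ht : 0 < t)
    (ht1 : t ≤ 1) :
    (fun x : CSpace (m + 1) => fun i => inner ℂ (b i) x) ⁻¹'
        koranyiBox m (1 / 4) (1 / 2) (t / 32) (√(t / (64 * (m + 1)))) ⊆
      Set.Ioo (0 : ℝ) 1 • (Subtype.val '' koranyiBall (ζ : CSpace (m + 1)) t) := by
  intro x hx
  obtain ⟨⟨⟨h1, h2⟩, h3, h4⟩, h5⟩ := mem_koranyiBox.1 hx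
  have hsum := b.sum_sq_norm_inner_right x
  rw [Fin.sum_univ_succ] at hsum
  set w : ℂ := inner ℂ (b 0) x with hw
  have hS : ∑ i : Fin m, ‖inner ℂ (b i.succ) x‖ ^ 2 ≤ t / 64 := by
    have : ∑ i : Fin m, ‖inner ℂ (b i.succ) x‖ ^ 2 ≤ ∑ i : Fin m, t / (64 * (m + 1)) := by
      refine Finset.sum_le_sum fun i _ => ?_
      have := h5 i
      exact (Real.lt_sqrt (norm_nonneg _)).1 this |>.le
    refine this.trans ?_
    rw [Finset.sum_const, Finset.card_univ, Fintype.card_fin, nsmul_eq_mul,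
      mul_div_assoc', div_le_div_iff₀ (by positivity) (by positivity)]
    nlinarith
  have hS0 : 0 ≤ ∑ i : Fin m, ‖inner ℂ (b i.succ) x‖ ^ 2 :=
    Finset.sum_nonneg fun _ _ => sq_nonneg _
  have hwn : ‖w‖ ^ 2 = w.re ^ 2 + w.im ^ 2 := by
    rw [Complex.sq_norm, Complex.normSq_apply]; ring
  have him : |w.im| < t / 32 := abs_lt.2 ⟨h3, h4⟩
  have him2 : w.im ^ 2 ≤ t / 32 * (1 / 32) := by
    rw [← sq_abs]; nlinarith [abs_nonneg w.im]
  set R := ‖x‖ with hR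
  have hR0 : 0 ≤ R := norm_nonneg x
  have hRre : w.re ≤ R := by nlinarith [sq_nonneg w.im]
  have hR1 : R < 1 := by nlinarith
  have hRpos : 0 < R := by linarith
  have hRw : R - w.re ≤ t / 16 := by nlinarith
  have hunit : ‖(R⁻¹ : ℝ) • x‖ = 1 := by
    rw [norm_smul, norm_inv, Real.norm_of_nonneg hR0, ← hR, inv_mul_cancel₀ hRpos.ne']
  refine ⟨R, ⟨hRpos, hR1⟩, (R⁻¹ : ℝ) • x, ⟨⟨(R⁻¹ : ℝ) • x, by simpa using hunit⟩, ?_, rfl⟩, ?_⟩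
  · change ‖1 - herm _ _‖ < t
    rw [norm_one_sub_herm_comm]
    have h6 : herm ((R⁻¹ : ℝ) • x) (ζ : CSpace (m + 1)) = (R⁻¹ : ℝ) * w := by
      rw [herm, ← Complex.coe_smul, inner_smul_right, hw, hb]
    have h7 : (1 : ℂ) - (R⁻¹ : ℝ) * w = (R⁻¹ : ℝ) * (R - w) := by
      have : (R : ℂ) ≠ 0 := by exact_mod_cast hRpos.ne'
      push_cast; field_simp
    change ‖1 - herm ((R⁻¹ : ℝ) • x) (ζ : CSpace (m + 1))‖ < t
    rw [h6, h7, norm_mul, Complex.norm_real, norm_inv, Real.norm_of_nonneg hR0,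
      inv_mul_lt_iff₀ hRpos]
    have h8 := Complex.norm_le_abs_re_add_abs_im ((R : ℂ) - w)
    rw [Complex.sub_re, Complex.sub_im, Complex.ofReal_re, Complex.ofReal_im, zero_sub, abs_neg,
      abs_of_nonneg (by linarith : 0 ≤ R - w.re)] at h8
    nlinarith
  · change R • (R⁻¹ : ℝ) • x = x
    rw [smul_smul, mul_inv_cancel₀ hRpos.ne', one_smul]

theorem exists_sphereMeasure_koranyiBall_le {n : ℕ} (hn : 1 ≤ n) : ∃ C : ℝ≥0, 0 < C ∧
    ∀ (ζ : USphere n) (t : ℝ), 0 ≤ t →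
      sphereMeasure n (koranyiBall (ζ : CSpace n) t) ≤ C * ENNReal.ofReal (t ^ n) := by
  obtain ⟨m, rfl⟩ : ∃ m, n = m + 1 := ⟨n - 1, by omega⟩
  obtain ⟨c, hc0, hc1, hc⟩ := exists_sphereMeasure_apply_eq hn
  obtain ⟨κ, hκ0, hκ1, hκ⟩ := exists_volume_coordinates_eq (m + 1)
  have hpi : (NNReal.pi : ℝ≥0∞) ≠ 0 := by simpa using NNReal.pi_pos.ne'
  set C : ℝ≥0∞ := c * (κ * (ENNReal.ofReal 4 * 2 * (2 * NNReal.pi) ^ m)) with hC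
  have hC1 : C ≠ ∞ := by finiteness
  have hC0 : C ≠ 0 := by
    simp [hC, hc0, hκ0, hpi, -ENNReal.coe_eq_zero]
  refine ⟨C.toNNReal, ENNReal.toNNReal_pos hC0 hC1, fun ζ t ht => ?_⟩
  rw [ENNReal.coe_toNNReal hC1, hc _ (isOpen_koranyiBall _ _).measurableSet]
  obtain ⟨b, hb⟩ := exists_orthonormalBasis_zero_eq ζ
  refine (mul_le_mul_right (measure_mono (cone_koranyiBall_subset ζ b hb)) c).trans (le_of_eq ?_)
  rw [hκ b _ (measurableSet_koranyiBox _ _ _ _ _), volume_koranyiBox,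
    ← ENNReal.ofReal_pow (Real.sqrt_nonneg _), Real.sq_sqrt (by positivity),
    ENNReal.ofReal_mul (by norm_num : (0 : ℝ) ≤ 2), ENNReal.ofReal_pow ht, hC]
  norm_num
  ring

theorem exists_le_sphereMeasure_koranyiBall {n : ℕ} (hn : 1 ≤ n) : ∃ C : ℝ≥0, 0 < C ∧
    ∀ (ζ : USphere n) (t : ℝ), 0 < t → t ≤ 1 →
      C * ENNReal.ofReal (t ^ n) ≤ sphereMeasure n (koranyiBall (ζ : CSpace n) t) := by
  obtain ⟨m, rfl⟩ : ∃ m, n = m + 1 := ⟨n - 1, by omega⟩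
  obtain ⟨c, hc0, hc1, hc⟩ := exists_sphereMeasure_apply_eq hn
  obtain ⟨κ, hκ0, hκ1, hκ⟩ := exists_volume_coordinates_eq (m + 1)
  have hpi : (NNReal.pi : ℝ≥0∞) ≠ 0 := by simpa using NNReal.pi_pos.ne'
  have hk : 0 < (64 * ((m : ℝ) + 1))⁻¹ := by positivity
  set C : ℝ≥0∞ := c * (κ * (ENNReal.ofReal (1 / 4) * ENNReal.ofReal (1 / 16) *
    (ENNReal.ofReal (64 * (m + 1))⁻¹ * NNReal.pi) ^ m)) with hC
  have hC1 : C ≠ ∞ := by finiteness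
  have hC0 : C ≠ 0 := by
    have h : ENNReal.ofReal (64 * ((m : ℝ) + 1))⁻¹ ≠ 0 := (ENNReal.ofReal_pos.2 hk).ne'
    exact mul_ne_zero hc0 (mul_ne_zero hκ0 (mul_ne_zero (by norm_num)
      (pow_ne_zero _ (mul_ne_zero h hpi))))
  refine ⟨C.toNNReal, ENNReal.toNNReal_pos hC0 hC1, fun ζ t ht ht1 => ?_⟩
  rw [ENNReal.coe_toNNReal hC1, hc _ (isOpen_koranyiBall _ _).measurableSet]
  obtain ⟨b, hb⟩ := exists_orthonormalBasis_zero_eq ζ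
  refine le_trans (le_of_eq ?_)
    (mul_le_mul_right (measure_mono (koranyiBox_subset_cone ζ b hb ht ht1)) c)
  rw [hκ b _ (measurableSet_koranyiBox _ _ _ _ _), volume_koranyiBox,
    ← ENNReal.ofReal_pow (Real.sqrt_nonneg _), Real.sq_sqrt (by positivity),
    div_eq_mul_inv t (64 * _), ENNReal.ofReal_mul ht.le, show 2 * (t / 32) = 1 / 16 * t by ring,
    ENNReal.ofReal_mul (by norm_num : (0 : ℝ) ≤ 1 / 16), ENNReal.ofReal_pow ht.le, hC]
  norm_num
  ring

/-! ### The maximal operator: weak and strong type -/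

/-- The dyadic Hardy–Littlewood maximal function over Korányi balls, normalized by the size `tⁿ` of
the ball of radius `t`. -/
noncomputable def koranyiMaximal {n : ℕ} (f : USphere n → ℝ≥0∞) (ζ : USphere n) : ℝ≥0∞ :=
  ⨆ k : ℤ, (∫⁻ η in koranyiBall (ζ : CSpace n) (2 ^ k), f η ∂(sphereMeasure n)) /
    ENNReal.ofReal ((2 ^ k) ^ n)

theorem measurableSet_koranyiBall_prod (n : ℕ) (t : ℝ) :
    MeasurableSet {x : USphere n × USphere n | x.2 ∈ koranyiBall (x.1 : CSpace n) t} := by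
  have h : Continuous fun x : USphere n × USphere n =>
      ‖1 - herm (x.1 : CSpace n) (x.2 : CSpace n)‖ := by
    unfold herm; fun_prop
  exact measurableSet_lt h.measurable measurable_const

theorem measurable_koranyiMaximal {n : ℕ} {f : USphere n → ℝ≥0∞} (hf : Measurable f) :
    Measurable (koranyiMaximal f) := by
  refine Measurable.iSup fun k => Measurable.div_const ?_ _
  have h : ∀ ζ : USphere n,
      ∫⁻ η in koranyiBall (ζ : CSpace n) (2 ^ k), f η ∂(sphereMeasure n) =
      ∫⁻ η, {x : USphere n × USphere n | x.2 ∈ koranyiBall (x.1 : CSpace n) (2 ^ k)}.indicator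
        (fun x => f x.2) (ζ, η) ∂(sphereMeasure n) := by
    intro ζ
    rw [← lintegral_indicator (isOpen_koranyiBall _ _).measurableSet]
    rfl
  simp_rw [h]
  exact ((hf.comp measurable_snd).indicator
    (measurableSet_koranyiBall_prod n _)).lintegral_prod_right'

theorem lintegral_koranyiBall_zpow_le {n : ℕ} (f : USphere n → ℝ≥0∞) (ζ : USphere n) (k : ℤ) :
    ∫⁻ η in koranyiBall (ζ : CSpace n) (2 ^ k), f η ∂(sphereMeasure n) ≤
      ENNReal.ofReal ((2 ^ k) ^ n) * koranyiMaximal f ζ := by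
  rw [mul_comm, ← ENNReal.div_le_iff (by simp; positivity) ENNReal.ofReal_ne_top]
  exact le_iSup (fun k : ℤ => (∫⁻ η in koranyiBall (ζ : CSpace n) (2 ^ k), f η ∂(sphereMeasure n)) /
    ENNReal.ofReal ((2 ^ k) ^ n)) k

theorem lintegral_koranyiBall_le {n : ℕ} (f : USphere n → ℝ≥0∞) (ζ : USphere n) {t : ℝ}
    (ht : 0 < t) :
    ∫⁻ η in koranyiBall (ζ : CSpace n) t, f η ∂(sphereMeasure n) ≤
      ENNReal.ofReal ((2 * t) ^ n) * koranyiMaximal f ζ := by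
  obtain ⟨k, hk1, hk2⟩ := exists_mem_Ioc_zpow ht (one_lt_two : (1 : ℝ) < 2)
  refine (lintegral_mono_set (koranyiBall_mono _ hk2)).trans
    ((lintegral_koranyiBall_zpow_le f ζ (k + 1)).trans ?_)
  gcongr
  rw [zpow_add_one₀ two_ne_zero]
  linarith

theorem koranyiMaximal_le_of_le {n : ℕ} {C : ℝ≥0}
    (hC : ∀ (ζ : USphere n) (t : ℝ), 0 ≤ t →
      sphereMeasure n (koranyiBall (ζ : CSpace n) t) ≤ C * ENNReal.ofReal (t ^ n))
    {f : USphere n → ℝ≥0∞} {c : ℝ≥0∞} (hf : ∀ η, f η ≤ c) (ζ : USphere n) :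
    koranyiMaximal f ζ ≤ c * C := by
  refine iSup_le fun k => ENNReal.div_le_of_le_mul ?_
  refine (lintegral_mono hf).trans ?_
  rw [setLIntegral_const, mul_assoc]
  gcongr
  exact hC _ _ (by positivity)

theorem koranyiMaximal_add_le {n : ℕ} {f g : USphere n → ℝ≥0∞} (hf : Measurable f)
    (ζ : USphere n) :
    koranyiMaximal (fun η => f η + g η) ζ ≤ koranyiMaximal f ζ + koranyiMaximal g ζ := by
  refine iSup_le fun k => ?_
  rw [lintegral_add_left hf, ENNReal.add_div]
  exact add_le_add (le_iSup (fun k : ℤ => (∫⁻ η in koranyiBall (ζ : CSpace n) (2 ^ k), f η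
      ∂(sphereMeasure n)) / ENNReal.ofReal ((2 ^ k) ^ n)) k)
    (le_iSup (fun k : ℤ => (∫⁻ η in koranyiBall (ζ : CSpace n) (2 ^ k), g η
      ∂(sphereMeasure n)) / ENNReal.ofReal ((2 ^ k) ^ n)) k)

/-- The weak type `(1, 1)` inequality. -/
theorem exists_koranyiMaximal_weak_type {n : ℕ} (hn : 1 ≤ n) : ∃ W : ℝ≥0,
    ∀ (f : USphere n → ℝ≥0∞) (l : ℝ≥0∞),
      l * sphereMeasure n {ζ | l < koranyiMaximal f ζ} ≤ W * ∫⁻ η, f η ∂(sphereMeasure n) := by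
  obtain ⟨C, hC0, hC⟩ := exists_sphereMeasure_koranyiBall_le hn
  refine ⟨C * 12 ^ n, fun f l => ?_⟩
  rcases eq_or_ne (∫⁻ η, f η ∂(sphereMeasure n)) ∞ with hI | hI
  · rw [hI, ENNReal.mul_top (by simpa using hC0.ne')]
    exact le_top
  rcases eq_or_ne l 0 with hl | hl
  · simp [hl]
  rcases eq_or_ne l ∞ with hl' | hl'
  · simp [hl']
  set E : Set (USphere n) := {ζ | l < koranyiMaximal f ζ} with hE
  have hk : ∀ ζ ∈ E, ∃ k : ℤ, l * ENNReal.ofReal ((2 ^ k) ^ n) <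
      ∫⁻ η in koranyiBall (ζ : CSpace n) (2 ^ k), f η ∂(sphereMeasure n) := by
    intro ζ hζ
    obtain ⟨k, hk⟩ := lt_iSup_iff.1 (show l < koranyiMaximal f ζ from hζ)
    refine ⟨k, ?_⟩
    rwa [ENNReal.lt_div_iff_mul_lt (Or.inl (by simp; positivity))
      (Or.inl ENNReal.ofReal_ne_top)] at hk
  choose! k hk using hk
  -- The size of a ball is the n-th power of its radius, bounded by (∫ f)/l because of `hk`. Factor
  -- 2ⁿ in size is factor 2 in radius, so the quasi-triangle inequality gives the enlargement 4(1 +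
  -- 2) = 12.
  obtain ⟨u, hu, hdisj, hcov⟩ := Vitali.exists_disjoint_subfamily_covering_enlargement
    (fun ζ : USphere n => koranyiBall (ζ : CSpace n) (2 ^ k ζ)) E (fun ζ => ((2 : ℝ) ^ k ζ) ^ n)
    (2 ^ n) (one_lt_pow₀ one_lt_two (by omega)) (fun _ _ => by positivity)
    ((∫⁻ η, f η ∂(sphereMeasure n)) / l).toReal
    (fun ζ hζ => by
      rw [← ENNReal.ofReal_le_iff_le_toReal (ENNReal.div_ne_top hI hl),
        ENNReal.le_div_iff_mul_le (Or.inl hl) (Or.inl hl'), mul_comm]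
      exact (hk ζ hζ).le.trans (setLIntegral_le_lintegral _ _))
    (fun ζ _ => ⟨ζ, mem_koranyiBall_self ζ (by positivity)⟩)
  have hcount : u.Countable := hdisj.countable_of_isOpen (fun _ _ => isOpen_koranyiBall _ _)
    (fun ζ _ => ⟨ζ, mem_koranyiBall_self ζ (by positivity)⟩)
  have hsub : E ⊆ ⋃ b ∈ u, koranyiBall (b : CSpace n) (12 * 2 ^ k b) := by
    intro a ha
    obtain ⟨b, hb, ⟨x, hxa, hxb⟩, hab⟩ := hcov a ha
    refine Set.mem_biUnion hb ?_
    have h2 : (2 : ℝ) ^ k a ≤ 2 * 2 ^ k b := by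
      rw [← mul_pow] at hab
      exact (pow_le_pow_iff_left₀ (by positivity) (by positivity) (by omega)).1 hab
    have h3 : ‖1 - herm (a : CSpace n) (x : CSpace n)‖ < 2 ^ k a := hxa
    have h4 : ‖1 - herm (b : CSpace n) (x : CSpace n)‖ < 2 ^ k b := hxb
    have h5 := norm_one_sub_herm_triangle (a := (b : CSpace n)) (b := (x : CSpace n))
      (c := (a : CSpace n)) (by simp) (by simp) (by simp)
    rw [norm_one_sub_herm_comm (x : CSpace n)] at h5
    change ‖1 - herm (b : CSpace n) (a : CSpace n)‖ < _
    linarith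
  have hu' : Countable u := hcount.to_subtype
  calc l * sphereMeasure n E
      ≤ l * ∑' b : u, sphereMeasure n (koranyiBall (b : CSpace n) (12 * 2 ^ k b)) := by
        gcongr
        refine (measure_mono hsub).trans ?_
        exact measure_biUnion_le _ hcount _
    _ ≤ l * ∑' b : u, (C * 12 ^ n : ℝ≥0) * ENNReal.ofReal ((2 ^ k b) ^ n) := by
        gcongr with b
        refine (hC _ _ (by positivity)).trans (le_of_eq ?_)
        rw [mul_pow, ENNReal.ofReal_mul (by positivity), ENNReal.ofReal_pow (by norm_num)]
        push_cast
        norm_num [mul_assoc]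
    _ = (C * 12 ^ n : ℝ≥0) * ∑' b : u, l * ENNReal.ofReal ((2 ^ k b) ^ n) := by
        rw [ENNReal.tsum_mul_left, ENNReal.tsum_mul_left]; ring
    _ ≤ (C * 12 ^ n : ℝ≥0) *
        ∑' b : u, ∫⁻ η in koranyiBall (b : CSpace n) (2 ^ k b), f η ∂(sphereMeasure n) := by
        gcongr with b
        exact (hk b (hu b.2)).le
    _ ≤ (C * 12 ^ n : ℝ≥0) * ∫⁻ η, f η ∂(sphereMeasure n) := by
        gcongr
        rw [← lintegral_biUnion hcount (fun _ _ => (isOpen_koranyiBall _ _).measurableSet) hdisj]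
        exact setLIntegral_le_lintegral _ _

theorem ENNReal.exists_two_rpow_lt_le {a : ℝ≥0∞} (h0 : a ≠ 0) (h1 : a ≠ ∞) :
    ∃ m : ℤ, (2 : ℝ≥0∞) ^ (m : ℝ) < a ∧ a ≤ 2 ^ ((m : ℝ) + 1) := by
  obtain ⟨m, hm1, hm2⟩ := ENNReal.exists_mem_Ioc_zpow h0 h1 ENNReal.one_lt_two ENNReal.ofNat_ne_top
  refine ⟨m, by rwa [ENNReal.rpow_intCast], ?_⟩
  rw [← ENNReal.rpow_intCast] at hm2
  exact_mod_cast hm2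

-- A discrete layer-cake bound: the single level with 2^k < a ≤ 2^(k+1) already suffices. For a = ∞
-- it is applied to arbitrarily large finite b ≤ a.
open Classical in
theorem ENNReal.rpow_le_tsum_dyadic {p : ℝ} (hp : 0 < p) (a : ℝ≥0∞) :
    a ^ p ≤ ∑' k : ℤ, if (2 : ℝ≥0∞) ^ (k : ℝ) < a then ((2 : ℝ≥0∞) ^ ((k : ℝ) + 1)) ^ p else 0 := by
  have hfin : ∀ b : ℝ≥0∞, b ≠ ∞ → b ≤ a → b ^ p ≤ ∑' k : ℤ,
      if (2 : ℝ≥0∞) ^ (k : ℝ) < a then ((2 : ℝ≥0∞) ^ ((k : ℝ) + 1)) ^ p else 0 := by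
    intro b hb hba
    rcases eq_or_ne b 0 with h0 | h0
    · simp [h0, hp]
    obtain ⟨m, hm1, hm2⟩ := ENNReal.exists_two_rpow_lt_le h0 hb
    refine le_trans ?_ (ENNReal.le_tsum m)
    rw [if_pos (hm1.trans_le hba)]
    exact ENNReal.rpow_le_rpow hm2 hp.le
  rcases eq_or_ne a ∞ with ha | ha
  · refine le_top.trans (ENNReal.eq_top_of_forall_nnreal_le fun r => ?_).ge
    refine le_trans (le_of_eq ?_) (hfin ((r : ℝ≥0∞) ^ (1 / p))
      (ENNReal.rpow_ne_top_of_nonneg (by positivity) ENNReal.coe_ne_top) (ha ▸ le_top))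
    rw [← ENNReal.rpow_mul, one_div, inv_mul_cancel₀ hp.ne', ENNReal.rpow_one]
  · exact hfin a ha le_rfl

-- The levels below b run downwards from the top one, so the sum is a geometric series of ratio
-- 2^(-q).
open Classical in
theorem ENNReal.exists_tsum_dyadic_le {q : ℝ} (hq : 0 < q) : ∃ S : ℝ≥0, ∀ b : ℝ≥0∞,
    (∑' k : ℤ, if (2 : ℝ≥0∞) ^ (k : ℝ) < b then ((2 : ℝ≥0∞) ^ (k : ℝ)) ^ q else 0) ≤ S * b ^ q := by
  have hr : (2 : ℝ≥0∞) ^ (-q) < 1 :=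
    ENNReal.rpow_lt_one_of_one_lt_of_neg ENNReal.one_lt_two (by linarith)
  have hS1 : (1 - (2 : ℝ≥0∞) ^ (-q))⁻¹ ≠ ∞ := by
    simpa [tsub_eq_zero_iff_le] using hr
  have hS0 : (1 - (2 : ℝ≥0∞) ^ (-q))⁻¹ ≠ 0 := by
    simp
  refine ⟨(1 - (2 : ℝ≥0∞) ^ (-q))⁻¹.toNNReal, fun b => ?_⟩
  rw [ENNReal.coe_toNNReal hS1]
  rcases eq_or_ne b ∞ with hb | hb
  · rw [hb, ENNReal.top_rpow_of_pos hq, ENNReal.mul_top hS0]; exact le_top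
  rcases eq_or_ne b 0 with h0 | h0
  · simp [h0]
  obtain ⟨m, hm1, hm2⟩ := ENNReal.exists_two_rpow_lt_le h0 hb
  have hinj : Function.Injective fun j : ℕ => m - (j : ℤ) := fun i j h => by
    simpa using h
  rw [← hinj.tsum_eq (f := fun k : ℤ =>
    if (2 : ℝ≥0∞) ^ (k : ℝ) < b then ((2 : ℝ≥0∞) ^ (k : ℝ)) ^ q else 0)]
  · calc ∑' j : ℕ, (if (2 : ℝ≥0∞) ^ ((m - (j : ℤ) : ℤ) : ℝ) < b then
          ((2 : ℝ≥0∞) ^ ((m - (j : ℤ) : ℤ) : ℝ)) ^ q else 0)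
        ≤ ∑' j : ℕ, b ^ q * ((2 : ℝ≥0∞) ^ (-q)) ^ j := by
          refine ENNReal.tsum_le_tsum fun j => ?_
          split_ifs
          · have : ((2 : ℝ≥0∞) ^ ((m - (j : ℤ) : ℤ) : ℝ)) ^ q =
                ((2 : ℝ≥0∞) ^ (m : ℝ)) ^ q * ((2 : ℝ≥0∞) ^ (-q)) ^ j := by
              rw [← ENNReal.rpow_mul, ← ENNReal.rpow_mul, ← ENNReal.rpow_natCast,
                ← ENNReal.rpow_mul, ← ENNReal.rpow_add _ _ two_ne_zero ENNReal.ofNat_ne_top]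
              congr 1
              push_cast; ring
            rw [this]
            gcongr
          · exact zero_le
      _ = (1 - (2 : ℝ≥0∞) ^ (-q))⁻¹ * b ^ q := by
          rw [ENNReal.tsum_mul_left, ENNReal.tsum_geometric, mul_comm]
  · intro k hk
    have hk' : (2 : ℝ≥0∞) ^ (k : ℝ) < b := by
      by_contra h
      exact hk (if_neg h)
    have h2 : (2 : ℝ≥0∞) ^ (k : ℝ) < 2 ^ ((m : ℝ) + 1) := hk'.trans_le hm2
    have h3 : k < m + 1 := by
      by_contra h
      have h4 : ((m : ℝ) + 1) ≤ k := by exact_mod_cast not_lt.1 h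
      exact absurd h2 (not_lt.2 (ENNReal.rpow_le_rpow_of_exponent_le (by norm_num) h4))
    exact ⟨(m - k).toNat, by simp; omega⟩

/-- The strong type `(p, p)` inequality for `p > 1`. -/
theorem exists_koranyiMaximal_strong_type {n : ℕ} (hn : 1 ≤ n) {p : ℝ} (hp : 1 < p) : ∃ C : ℝ≥0,
    ∀ f : USphere n → ℝ≥0∞, Measurable f →
      ∫⁻ ζ, koranyiMaximal f ζ ^ p ∂(sphereMeasure n) ≤ C * ∫⁻ ζ, f ζ ^ p ∂(sphereMeasure n) := by
  classical
  obtain ⟨A, hA0, hA⟩ := exists_sphereMeasure_koranyiBall_le hn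
  obtain ⟨W, hW⟩ := exists_koranyiMaximal_weak_type hn
  obtain ⟨S, hS⟩ := ENNReal.exists_tsum_dyadic_le (q := p - 1) (by linarith)
  have hA0' : (A : ℝ≥0∞) ≠ 0 := by exact_mod_cast hA0.ne'
  have h2A : (2 * A : ℝ≥0∞) ≠ 0 := mul_ne_zero two_ne_zero hA0'
  have h2A' : (2 * A : ℝ≥0∞) ≠ ∞ := by finiteness
  set D : ℝ≥0∞ := W * 2 ^ (p + 1) * (S * (2 * A) ^ (p - 1)) with hD
  have hD1 : D ≠ ∞ := by
    have h1 : (2 : ℝ≥0∞) ^ (p + 1) ≠ ∞ :=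
      ENNReal.rpow_ne_top_of_nonneg (by linarith) ENNReal.ofNat_ne_top
    have h3 : (2 * A : ℝ≥0∞) ^ (p - 1) ≠ ∞ := ENNReal.rpow_ne_top_of_nonneg (by linarith) h2A'
    finiteness
  refine ⟨D.toNNReal, fun f hf => ?_⟩
  rw [ENNReal.coe_toNNReal hD1]
  -- Marcinkiewicz splitting at height 2^k/(2A). Since M is normalized by tⁿ and σ of a ball is at
  -- most A tⁿ, the small part has maximal function at most 2^(k-1), so the large part must exceed
  -- 2^(k-1) wherever Mf > 2^k.
  set big : ℤ → Set (USphere n) := fun k => {η | (2 : ℝ≥0∞) ^ (k : ℝ) < 2 * A * f η} with hbig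
  have hbigm : ∀ k, MeasurableSet (big k) := fun k =>
    measurableSet_lt measurable_const (hf.const_mul _)
  have hMm := measurable_koranyiMaximal hf
  have hlevel : ∀ k : ℤ, (2 : ℝ≥0∞) ^ ((k : ℝ) - 1) *
      sphereMeasure n {ζ | (2 : ℝ≥0∞) ^ (k : ℝ) < koranyiMaximal f ζ} ≤
      W * ∫⁻ η, (big k).indicator f η ∂(sphereMeasure n) := by
    intro k
    refine le_trans (mul_le_mul_right (measure_mono fun ζ hζ => ?_) _)
      (hW ((big k).indicator f) (2 ^ ((k : ℝ) - 1)))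
    change _ < koranyiMaximal ((big k).indicator f) ζ
    have hζ' : (2 : ℝ≥0∞) ^ (k : ℝ) < koranyiMaximal f ζ := hζ
    have h1 : koranyiMaximal f ζ ≤ koranyiMaximal ((big k).indicator f) ζ +
        koranyiMaximal ((big k)ᶜ.indicator f) ζ := by
      refine le_trans (le_of_eq ?_) (koranyiMaximal_add_le (hf.indicator (hbigm k)) ζ)
      congr 1
      ext η
      exact (congrFun (Set.indicator_self_add_compl (big k) f) η).symm
    have h2 : koranyiMaximal ((big k)ᶜ.indicator f) ζ ≤ 2 ^ ((k : ℝ) - 1) := by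
      refine (koranyiMaximal_le_of_le hA (c := 2 ^ (k : ℝ) / (2 * A)) (fun η => ?_) ζ).trans
        (le_of_eq ?_)
      · by_cases hη : η ∈ big k
        · rw [Set.indicator_of_notMem (by simpa using hη)]; exact zero_le
        rw [Set.indicator_of_mem (by simpa using hη),
          ENNReal.le_div_iff_mul_le (Or.inl h2A) (Or.inl h2A'), mul_comm]
        exact not_lt.1 hη
      · rw [ENNReal.rpow_sub _ _ two_ne_zero ENNReal.ofNat_ne_top, ENNReal.rpow_one,
          ENNReal.div_eq_inv_mul, ENNReal.div_eq_inv_mul,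
          ENNReal.mul_inv (Or.inl two_ne_zero) (Or.inl ENNReal.ofNat_ne_top)]
        calc (2 : ℝ≥0∞)⁻¹ * (A : ℝ≥0∞)⁻¹ * 2 ^ (k : ℝ) * A
            = 2⁻¹ * 2 ^ (k : ℝ) * ((A : ℝ≥0∞)⁻¹ * A) := by ring
          _ = _ := by rw [ENNReal.inv_mul_cancel hA0' ENNReal.coe_ne_top, mul_one]
    have h3 : (2 : ℝ≥0∞) ^ (k : ℝ) = 2 ^ ((k : ℝ) - 1) + 2 ^ ((k : ℝ) - 1) := by
      rw [← two_mul]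
      nth_rewrite 2 [← ENNReal.rpow_one 2]
      rw [← ENNReal.rpow_add _ _ two_ne_zero ENNReal.ofNat_ne_top]
      congr 1; ring
    by_contra hcon
    have h4 := h1.trans (add_le_add (not_lt.1 hcon) h2)
    rw [← h3] at h4
    exact absurd hζ' (not_lt.2 h4)
  have hE : ∀ k : ℤ, MeasurableSet {ζ | (2 : ℝ≥0∞) ^ (k : ℝ) < koranyiMaximal f ζ} := fun k =>
    measurableSet_lt measurable_const hMm
  calc ∫⁻ ζ, koranyiMaximal f ζ ^ p ∂(sphereMeasure n)
      ≤ ∫⁻ ζ, ∑' k : ℤ, {ζ | (2 : ℝ≥0∞) ^ (k : ℝ) < koranyiMaximal f ζ}.indicator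
          (fun _ => ((2 : ℝ≥0∞) ^ ((k : ℝ) + 1)) ^ p) ζ ∂(sphereMeasure n) := by
        refine lintegral_mono fun ζ => ?_
        simpa [Set.indicator_apply] using
          ENNReal.rpow_le_tsum_dyadic (by linarith : 0 < p) (koranyiMaximal f ζ)
    _ = ∑' k : ℤ, ((2 : ℝ≥0∞) ^ ((k : ℝ) + 1)) ^ p *
          sphereMeasure n {ζ | (2 : ℝ≥0∞) ^ (k : ℝ) < koranyiMaximal f ζ} := by
        rw [lintegral_tsum fun k => (measurable_const.indicator (hE k)).aemeasurable]
        simp_rw [lintegral_indicator_const (hE _)]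
    -- One factor 2^(k-1) is split off for the weak type bound; the remaining (2^k)^(p-1) is summed
    -- over the levels 2^k < 2A f(η), which converges because p > 1.
    _ = ∑' k : ℤ, (2 ^ (p + 1) * ((2 : ℝ≥0∞) ^ (k : ℝ)) ^ (p - 1)) * (2 ^ ((k : ℝ) - 1) *
          sphereMeasure n {ζ | (2 : ℝ≥0∞) ^ (k : ℝ) < koranyiMaximal f ζ}) := by
        refine tsum_congr fun k => ?_
        rw [← mul_assoc]
        congr 1
        rw [← ENNReal.rpow_mul, ← ENNReal.rpow_mul,
          ← ENNReal.rpow_add _ _ two_ne_zero ENNReal.ofNat_ne_top,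
          ← ENNReal.rpow_add _ _ two_ne_zero ENNReal.ofNat_ne_top]
        congr 1; ring
    _ ≤ ∑' k : ℤ, (2 ^ (p + 1) * ((2 : ℝ≥0∞) ^ (k : ℝ)) ^ (p - 1)) *
          (W * ∫⁻ η, (big k).indicator f η ∂(sphereMeasure n)) := by
        exact ENNReal.tsum_le_tsum fun k => mul_le_mul_right (hlevel k) _
    _ = ∑' k : ℤ, ∫⁻ η, W * 2 ^ (p + 1) * (((2 : ℝ≥0∞) ^ (k : ℝ)) ^ (p - 1) *
          (big k).indicator f η) ∂(sphereMeasure n) := by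
        refine tsum_congr fun k => ?_
        rw [lintegral_const_mul _ ((hf.indicator (hbigm k)).const_mul _),
          lintegral_const_mul _ (hf.indicator (hbigm k))]
        ring
    _ = ∫⁻ η, ∑' k : ℤ, W * 2 ^ (p + 1) * (((2 : ℝ≥0∞) ^ (k : ℝ)) ^ (p - 1) *
          (big k).indicator f η) ∂(sphereMeasure n) := by
        rw [lintegral_tsum fun k =>
          (((hf.indicator (hbigm k)).const_mul _).const_mul _).aemeasurable]
    _ ≤ ∫⁻ η, D * f η ^ p ∂(sphereMeasure n) := by
        refine lintegral_mono fun η => ?_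
        have h1 : ∀ k : ℤ, W * 2 ^ (p + 1) * (((2 : ℝ≥0∞) ^ (k : ℝ)) ^ (p - 1) *
            (big k).indicator f η) = W * 2 ^ (p + 1) * f η * (if (2 : ℝ≥0∞) ^ (k : ℝ) <
              2 * A * f η then ((2 : ℝ≥0∞) ^ (k : ℝ)) ^ (p - 1) else 0) := by
          intro k
          rw [Set.indicator_apply]
          change _ * (_ * (if (2 : ℝ≥0∞) ^ (k : ℝ) < 2 * A * f η then _ else _)) = _
          split_ifs
          · ring
          · simp
        simp_rw [h1]
        rw [ENNReal.tsum_mul_left]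
        refine (mul_le_mul_right (hS (2 * A * f η)) _).trans (le_of_eq ?_)
        have h2 : f η ^ p = f η * f η ^ (p - 1) := by
          conv_lhs => rw [show p = 1 + (p - 1) by ring]
          rw [ENNReal.rpow_add_of_nonneg _ _ zero_le_one (by linarith), ENNReal.rpow_one]
        rw [ENNReal.mul_rpow_of_nonneg _ _ (by linarith : 0 ≤ p - 1), h2, hD]
        ring
    _ = D * ∫⁻ ζ, f ζ ^ p ∂(sphereMeasure n) := lintegral_const_mul _ (hf.pow_const _)

/-! ### The invariant Poisson kernel, its maximal domination, and shadows -/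

theorem one_sub_norm_sq_pos {n : ℕ} (z : UBall n) : 0 < 1 - ‖(z : CSpace n)‖ ^ 2 := by
  have h : ‖(z : CSpace n)‖ < 1 := mem_ball_zero_iff.1 z.2
  nlinarith [norm_nonneg (z : CSpace n)]

theorem norm_one_sub_herm_ball_pos {n : ℕ} (z : UBall n) (ζ : USphere n) :
    0 < ‖1 - herm (z : CSpace n) (ζ : CSpace n)‖ := by
  have h : ‖(z : CSpace n)‖ < 1 := mem_ball_zero_iff.1 z.2
  exact (sub_pos.2 h).trans_le (one_sub_norm_le_herm (by simp))

theorem invPoissonKernel_nonneg {n : ℕ} (z : UBall n) (ζ : USphere n) :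
    0 ≤ invPoissonKernel z ζ :=
  div_nonneg (pow_nonneg (one_sub_norm_sq_pos z).le _) (by positivity)

theorem measurable_invPoissonKernel (n : ℕ) :
    Measurable fun x : UBall n × USphere n => invPoissonKernel x.1 x.2 := by
  unfold invPoissonKernel
  refine Measurable.div ?_ ?_ <;> refine Continuous.measurable ?_
  · fun_prop
  · unfold herm; fun_prop

theorem invPoissonKernel_le {n : ℕ} {r : ℝ} (hr : r < 1) {z : UBall n}
    (hz : ‖(z : CSpace n)‖ ≤ r) (ζ : USphere n) :
    invPoissonKernel z ζ ≤ ((1 - r) ^ (2 * n))⁻¹ := by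
  have h0 := one_sub_norm_sq_pos z
  have h1 : 1 - r ≤ ‖1 - herm (z : CSpace n) (ζ : CSpace n)‖ :=
    (sub_le_sub_left hz 1).trans (one_sub_norm_le_herm (by simp))
  have h2 : 0 < 1 - r := by linarith
  rw [invPoissonKernel, ← one_div]
  gcongr
  exact pow_le_one₀ h0.le (by nlinarith [norm_nonneg (z : CSpace n)])

theorem le_invPoissonKernel {n : ℕ} {β : ℝ} (hβ : 0 < β) {z : UBall n} {ζ : USphere n}
    (h : ζ ∈ koranyiBall (z : CSpace n) (β * (1 - ‖(z : CSpace n)‖ ^ 2))) :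
    (β ^ (2 * n) * (1 - ‖(z : CSpace n)‖ ^ 2) ^ n)⁻¹ ≤ invPoissonKernel z ζ := by
  have h0 := one_sub_norm_sq_pos z
  have h1 := norm_one_sub_herm_ball_pos z ζ
  have h2 : ‖1 - herm (z : CSpace n) (ζ : CSpace n)‖ < β * (1 - ‖(z : CSpace n)‖ ^ 2) := h
  rw [invPoissonKernel]
  set δ := 1 - ‖(z : CSpace n)‖ ^ 2
  calc (β ^ (2 * n) * δ ^ n)⁻¹ = δ ^ n / (β * δ) ^ (2 * n) := by
        rw [mul_pow, two_mul, pow_add δ]; field_simp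
    _ ≤ _ := by gcongr

/-- The Poisson integral of a nonnegative function, as a Lebesgue integral. -/
noncomputable def lPoisson {n : ℕ} (f : USphere n → ℝ≥0∞) (z : UBall n) : ℝ≥0∞ :=
  ∫⁻ ω, ENNReal.ofReal (invPoissonKernel z ω) * f ω ∂(sphereMeasure n)

theorem measurable_lPoisson {n : ℕ} {f : USphere n → ℝ≥0∞} (hf : Measurable f) :
    Measurable (lPoisson f) :=
  ((measurable_invPoissonKernel n).ennreal_ofReal.mul
    (hf.comp measurable_snd)).lintegral_prod_right'

theorem enorm_invPoissonIntegral_le {n : ℕ} (φ : USphere n → ℂ) (z : UBall n) :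
    ‖invPoissonIntegral φ z‖ₑ ≤ lPoisson (fun ω => ‖φ ω‖ₑ) z := by
  refine (enorm_integral_le_lintegral_enorm _).trans (lintegral_mono fun ω => ?_)
  rw [enorm_mul, ← ofReal_norm ((invPoissonKernel z ω : ℝ) : ℂ), Complex.norm_real,
    Real.norm_of_nonneg (invPoissonKernel_nonneg z ω)]

/-- Pointwise domination of Poisson integrals in an approach region by the maximal function. -/
theorem exists_lPoisson_le_koranyiMaximal {n : ℕ} (hn : 1 ≤ n) {β : ℝ} (hβ : 0 < β) : ∃ C : ℝ≥0,
    ∀ (f : USphere n → ℝ≥0∞), Measurable f → ∀ (z : UBall n) (ζ : USphere n),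
      ζ ∈ koranyiBall (z : CSpace n) (β * (1 - ‖(z : CSpace n)‖ ^ 2)) →
        lPoisson f z ≤ C * koranyiMaximal f ζ := by
  -- Chosen so that |1 - ⟨ζ, ω⟩| ≤ 4(βδ + |1 - ⟨z, ω⟩|) ≤ c |1 - ⟨z, ω⟩|, using δ ≤ 2|1 - ⟨z, ω⟩|.
  set c : ℝ := 4 * (2 * β + 1) with hc
  have hc0 : 0 < c := by positivity
  refine ⟨(c ^ (2 * n) * 4 ^ n).toNNReal * 2, fun f hf z ζ hζ => ?_⟩
  have hδ := one_sub_norm_sq_pos z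
  set δ : ℝ := 1 - ‖(z : CSpace n)‖ ^ 2 with hδd
  have hz : ‖(z : CSpace n)‖ < 1 := mem_ball_zero_iff.1 z.2
  have hζ' : ‖1 - herm (z : CSpace n) (ζ : CSpace n)‖ < β * δ := hζ
  -- Bound for the kernel where |1 - ⟨ζ, ω⟩| is about 2^j δ, or at most of order δ when j = 0. The
  -- ball of radius 2^(j+1) δ has size of order (2^j δ)ⁿ, so the j-th contribution decays like
  -- 2^(-nj).
  set a : ℕ → ℝ := fun j => c ^ (2 * n) * ((4 ^ n) ^ j * δ ^ n)⁻¹ with ha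
  have ha0 : ∀ j, 0 ≤ a j := fun j => by positivity
  have hker : ∀ ω, ENNReal.ofReal (invPoissonKernel z ω) * f ω ≤ ∑' j : ℕ, ENNReal.ofReal (a j) *
      (koranyiBall (ζ : CSpace n) (2 ^ (j + 1) * δ)).indicator f ω := by
    intro ω
    have h1 : δ ≤ 2 * ‖1 - herm (z : CSpace n) (ω : CSpace n)‖ := by
      have := one_sub_norm_le_herm (a := (z : CSpace n)) (b := (ω : CSpace n)) (by simp)
      nlinarith [norm_nonneg (z : CSpace n)]
    have h2 := norm_one_sub_herm_triangle (a := (ζ : CSpace n)) (b := (z : CSpace n))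
      (c := (ω : CSpace n)) (by simp) hz.le (by simp)
    rw [norm_one_sub_herm_comm (ζ : CSpace n) (z : CSpace n)] at h2
    have h3 : ‖1 - herm (ζ : CSpace n) (ω : CSpace n)‖ ≤
        c * ‖1 - herm (z : CSpace n) (ω : CSpace n)‖ := by
      nlinarith
    have h4 : δ ≤ c * ‖1 - herm (z : CSpace n) (ω : CSpace n)‖ := by
      nlinarith
    obtain ⟨j, hj1, hj2⟩ := exists_nat_pow_near
      (le_max_left 1 (‖1 - herm (ζ : CSpace n) (ω : CSpace n)‖ / δ)) (one_lt_two : (1 : ℝ) < 2)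
    refine le_trans ?_ (ENNReal.le_tsum j)
    rw [Set.indicator_of_mem]
    · gcongr
      have h5 : 2 ^ j * δ ≤ c * ‖1 - herm (z : CSpace n) (ω : CSpace n)‖ := by
        rcases le_max_iff.1 hj1 with h | h
        · nlinarith
        · exact ((le_div_iff₀ hδ).1 h).trans h3
      have h6 := norm_one_sub_herm_ball_pos z ω
      have h7 : 2 ^ j * δ / c ≤ ‖1 - herm (z : CSpace n) (ω : CSpace n)‖ := by
        rw [div_le_iff₀ hc0]; linarith
      calc invPoissonKernel z ω ≤ δ ^ n / (2 ^ j * δ / c) ^ (2 * n) := by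
            rw [invPoissonKernel]; gcongr
        _ = a j := by
            have h8 : ((4 : ℝ) ^ n) ^ j = (2 ^ j) ^ n * (2 ^ j) ^ n := by
              rw [pow_right_comm, ← mul_pow, ← mul_pow]; norm_num
            simp only [ha]
            rw [h8, div_pow, mul_pow, two_mul n, pow_add, pow_add, pow_add]
            field_simp
    · have := (le_max_right _ _).trans_lt hj2
      rwa [div_lt_iff₀ hδ] at this
  calc lPoisson f z ≤ ∫⁻ ω, ∑' j : ℕ, ENNReal.ofReal (a j) *
      (koranyiBall (ζ : CSpace n) (2 ^ (j + 1) * δ)).indicator f ω ∂(sphereMeasure n) :=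
        lintegral_mono hker
    _ = ∑' j : ℕ, ENNReal.ofReal (a j) *
        ∫⁻ ω in koranyiBall (ζ : CSpace n) (2 ^ (j + 1) * δ), f ω ∂(sphereMeasure n) := by
        rw [lintegral_tsum fun j => ((hf.indicator
          (isOpen_koranyiBall _ _).measurableSet).const_mul _).aemeasurable]
        refine tsum_congr fun j => ?_
        rw [lintegral_const_mul _ (hf.indicator (isOpen_koranyiBall _ _).measurableSet),
          lintegral_indicator (isOpen_koranyiBall _ _).measurableSet]
    _ ≤ ∑' j : ℕ, ENNReal.ofReal (c ^ (2 * n) * 4 ^ n) * koranyiMaximal f ζ * 2⁻¹ ^ j := by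
        refine ENNReal.tsum_le_tsum fun j => ?_
        refine (mul_le_mul_right (lintegral_koranyiBall_le f ζ (by positivity)) _).trans ?_
        have h1 : a j * (2 * (2 ^ (j + 1) * δ)) ^ n = c ^ (2 * n) * 4 ^ n * ((2 ^ n)⁻¹) ^ j := by
          have h2 : ((4 : ℝ) ^ n) ^ j = (2 ^ n) ^ j * (2 ^ n) ^ j := by
            rw [← mul_pow, ← mul_pow]; norm_num
          have h3 : (2 * (2 ^ (j + 1) * δ)) ^ n = 4 ^ n * (2 ^ n) ^ j * δ ^ n := by
            rw [← pow_mul, mul_comm n j, pow_mul, ← mul_pow, ← mul_pow]; ring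
          rw [h3, ha]
          simp only
          rw [h2, inv_pow]
          field_simp
        rw [← mul_assoc, ← ENNReal.ofReal_mul (ha0 j), h1,
          mul_right_comm (ENNReal.ofReal (c ^ (2 * n) * 4 ^ n))]
        gcongr
        have h4 : ((2 : ℝ) ^ n)⁻¹ ≤ 2⁻¹ := by
          gcongr
          exact le_self_pow₀ one_le_two (by omega)
        refine (ENNReal.ofReal_le_ofReal (mul_le_mul_of_nonneg_left
          (pow_le_pow_left₀ (by positivity) h4 j) (by positivity))).trans (le_of_eq ?_)
        rw [ENNReal.ofReal_mul (by positivity), ENNReal.ofReal_pow (by positivity),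
          ENNReal.ofReal_inv_of_pos two_pos]
        norm_num
    _ = _ := by
        rw [ENNReal.tsum_mul_left, ENNReal.tsum_geometric, ENNReal.one_sub_inv_two, inv_inv]
        push_cast
        rw [ENNReal.ofReal]
        ring

/-- For z = rη, |1 - ⟨z, ζ⟩| ≤ (1 - r) + |1 - ⟨η, ζ⟩|, and 1 - r ≤ (1 - r²)/(1 + ρ). The slack β -
1/(1 + ρ) leaves room for a Korányi ball about η of radius proportional to 1 - r². -/
theorem exists_le_sphereMeasure_shadow {n : ℕ} (hn : 1 ≤ n) {ρ β : ℝ} (hρ : 0 ≤ ρ)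
    (hβ : 1 / (1 + ρ) < β) : ∃ C : ℝ≥0, 0 < C ∧ ∀ z : UBall n, ρ ≤ ‖(z : CSpace n)‖ →
      C * ENNReal.ofReal ((1 - ‖(z : CSpace n)‖ ^ 2) ^ n) ≤
        sphereMeasure n (koranyiBall (z : CSpace n) (β * (1 - ‖(z : CSpace n)‖ ^ 2))) := by
  obtain ⟨C, hC0, hC⟩ := exists_le_sphereMeasure_koranyiBall hn
  have : Nonempty (Fin n) := ⟨⟨0, hn⟩⟩
  -- The cap at 1 keeps the radius ε(1 - r²) in the range t ≤ 1 of the lower ball estimate.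
  set ε : ℝ := min (β - 1 / (1 + ρ)) 1 with hε
  have hε0 : 0 < ε := lt_min (by linarith) one_pos
  refine ⟨C * (ε ^ n).toNNReal, by positivity, fun z hz => ?_⟩
  have hδ := one_sub_norm_sq_pos z
  set r : ℝ := ‖(z : CSpace n)‖ with hr
  have hr0 : 0 ≤ r := norm_nonneg _
  have hr1 : r < 1 := mem_ball_zero_iff.1 z.2
  obtain ⟨η, hη⟩ : ∃ η : USphere n, (z : CSpace n) = (r : ℂ) • (η : CSpace n) := by
    rcases eq_or_ne (z : CSpace n) 0 with h | h
    · obtain ⟨v, hv⟩ := (NormedSpace.sphere_nonempty (x := (0 : CSpace n)) (r := 1)).2 zero_le_one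
      exact ⟨⟨v, hv⟩, by simp [hr, h]⟩
    · have hr' : (r : ℂ) ≠ 0 := by simpa [hr] using h
      refine ⟨⟨(r : ℂ)⁻¹ • (z : CSpace n), ?_⟩, ?_⟩
      · have : r ≠ 0 := by exact_mod_cast hr'
        simp [norm_smul, ← hr, abs_of_nonneg hr0, this]
      · simp [smul_smul, hr']
  have hsub : koranyiBall (η : CSpace n) (ε * (1 - r ^ 2)) ⊆
      koranyiBall (z : CSpace n) (β * (1 - r ^ 2)) := by
    intro ζ hζ
    have h1 : ‖1 - herm (η : CSpace n) (ζ : CSpace n)‖ < ε * (1 - r ^ 2) := hζ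
    have h2 : 1 - herm (z : CSpace n) (ζ : CSpace n) =
        ((1 - r : ℝ) : ℂ) + (r : ℂ) * (1 - herm (η : CSpace n) (ζ : CSpace n)) := by
      rw [hη]
      simp only [herm, inner_smul_right]
      push_cast; ring
    have h3 : ‖1 - herm (z : CSpace n) (ζ : CSpace n)‖ ≤
        (1 - r) + r * ‖1 - herm (η : CSpace n) (ζ : CSpace n)‖ := by
      rw [h2]
      refine (norm_add_le _ _).trans (le_of_eq ?_)
      rw [norm_mul, Complex.norm_real, Complex.norm_real, Real.norm_of_nonneg hr0,
        Real.norm_of_nonneg (by linarith)]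
    have h4 : 1 - r ≤ 1 / (1 + ρ) * (1 - r ^ 2) := by
      rw [div_mul_eq_mul_div, le_div_iff₀ (by linarith)]
      nlinarith
    have h5 : ε ≤ β - 1 / (1 + ρ) := min_le_left _ _
    have h6 : r * ‖1 - herm (η : CSpace n) (ζ : CSpace n)‖ ≤
        ‖1 - herm (η : CSpace n) (ζ : CSpace n)‖ := mul_le_of_le_one_left (norm_nonneg _) hr1.le
    have h7 := mul_le_mul_of_nonneg_right h5 hδ.le
    change ‖1 - herm (z : CSpace n) (ζ : CSpace n)‖ < β * (1 - r ^ 2)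
    linarith
  refine le_trans (le_of_eq ?_) ((hC η (ε * (1 - r ^ 2)) (by positivity) ?_).trans
    (measure_mono hsub))
  · rw [mul_pow, ENNReal.ofReal_mul (by positivity), ← mul_assoc]
    push_cast
    rfl
  · exact mul_le_one₀ (min_le_right _ _) hδ.le (by nlinarith)

/-! ### Duality in Lebesgue spaces -/

theorem eLpNorm_ofReal_eq {X E : Type*} [MeasurableSpace X] [TopologicalSpace E]
    [ContinuousENorm E] {μ : Measure X} {r : ℝ} (hr : 0 < r) (f : X → E) :
    eLpNorm f (ENNReal.ofReal r) μ = (∫⁻ x, ‖f x‖ₑ ^ r ∂μ) ^ (1 / r) := by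
  rw [eLpNorm_eq_lintegral_rpow_enorm_toReal (by simpa using hr) ENNReal.ofReal_ne_top,
    ENNReal.toReal_ofReal hr.le]

/-- Duality: a bound on all pairings against `L^r` functions bounds the `L^q` norm. -/
theorem lintegral_rpow_le_of_forall_lintegral_mul_le {X : Type*} [MeasurableSpace X]
    {ν : Measure X} [IsFiniteMeasure ν] {r q : ℝ} (hrq : r.HolderConjugate q) {h : X → ℝ≥0∞}
    (hh : Measurable h) {L : ℝ≥0∞}
    (H : ∀ ψ : X → ℝ≥0∞, Measurable ψ → ∫⁻ x, ψ x ^ r ∂ν ≠ ∞ →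
      ∫⁻ x, ψ x * h x ∂ν ≤ L * (∫⁻ x, ψ x ^ r ∂ν) ^ (1 / r)) :
    (∫⁻ x, h x ^ q ∂ν) ^ (1 / q) ≤ L := by
  have hq0 : 0 < q := hrq.symm.pos
  have hr0 : 0 < r := hrq.pos
  have hq1 : 0 < q - 1 := hrq.symm.sub_one_pos
  have hexp : (q - 1) * r = q := by
    have := hrq.mul_eq_add
    linarith
  have hm : ∀ N : ℕ, Measurable fun x => min (h x) N := fun N => hh.min measurable_const
  -- The extremal test function h^(q-1) is truncated at height N, so that the integral Y is finite
  -- and Y^(1/r) can be cancelled from both sides.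
  have hN : ∀ N : ℕ, ∫⁻ x, min (h x) N ^ q ∂ν ≤ L ^ q := by
    intro N
    set Y : ℝ≥0∞ := ∫⁻ x, min (h x) N ^ q ∂ν with hY
    have hYtop : Y ≠ ∞ := by
      refine ne_top_of_le_ne_top ?_ (lintegral_mono fun x =>
        ENNReal.rpow_le_rpow (min_le_right (h x) (N : ℝ≥0∞)) hq0.le)
      rw [lintegral_const]
      exact ENNReal.mul_ne_top (ENNReal.rpow_ne_top_of_nonneg hq0.le (ENNReal.natCast_ne_top N))
        (measure_ne_top _ _)
    have hψ : ∀ x, (min (h x) N ^ (q - 1)) ^ r = min (h x) N ^ q := fun x => by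
      rw [← ENNReal.rpow_mul, hexp]
    have h1 := H (fun x => min (h x) N ^ (q - 1)) ((hm N).pow_const _) (by simpa only [hψ])
    simp only [hψ] at h1
    have h2 : Y ≤ L * Y ^ (1 / r) := by
      refine le_trans (lintegral_mono fun x => ?_) h1
      calc min (h x) N ^ q = min (h x) N ^ (q - 1) * min (h x) N := by
            conv_lhs => rw [show q = (q - 1) + 1 by ring]
            rw [ENNReal.rpow_add_of_nonneg _ _ hq1.le zero_le_one, ENNReal.rpow_one]
        _ ≤ _ := by gcongr; exact min_le_left _ _
    rcases eq_or_ne Y 0 with h0 | h0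
    · rw [h0]; exact zero_le
    have hZ0 : Y ^ (1 / r) ≠ 0 := by simp [h0, hYtop]
    have hZ1 : Y ^ (1 / r) ≠ ∞ := ENNReal.rpow_ne_top_of_nonneg (by positivity) hYtop
    have h3 : Y ^ (1 / q) ≤ L := by
      have h4 : Y = Y ^ (1 / q) * Y ^ (1 / r) := by
        rw [← ENNReal.rpow_add _ _ h0 hYtop]
        have : 1 / q + 1 / r = 1 := by simpa using hrq.symm.inv_add_inv_eq_one
        rw [this, ENNReal.rpow_one]
      rw [← ENNReal.mul_le_mul_iff_left hZ0 hZ1, ← h4]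
      exact h2
    calc Y = (Y ^ (1 / q)) ^ q := by
          rw [← ENNReal.rpow_mul, one_div, inv_mul_cancel₀ hq0.ne', ENNReal.rpow_one]
      _ ≤ L ^ q := ENNReal.rpow_le_rpow h3 hq0.le
  have hlim := lintegral_tendsto_of_tendsto_of_monotone (μ := ν)
    (f := fun (N : ℕ) x => min (h x) N ^ q) (F := fun x => h x ^ q)
    (fun N => ((hm N).pow_const _).aemeasurable)
    (Filter.Eventually.of_forall fun x M N hMN => by dsimp only; gcongr)
    (Filter.Eventually.of_forall fun x => by
      have := (tendsto_const_nhds (x := h x)).min ENNReal.tendsto_nat_nhds_top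
      rw [min_top_right] at this
      exact this.ennrpow_const q)
  have hle := le_of_tendsto' hlim hN
  calc (∫⁻ x, h x ^ q ∂ν) ^ (1 / q) ≤ (L ^ q) ^ (1 / q) :=
        ENNReal.rpow_le_rpow hle (by positivity)
    _ = L := by rw [← ENNReal.rpow_mul, mul_one_div_cancel hq0.ne', ENNReal.rpow_one]

/-! ### Fubini between approach regions and shadows -/

theorem measurableSet_approach (n : ℕ) (β : ℝ) : MeasurableSet {x : USphere n × UBall n |
    ‖1 - herm (x.2 : CSpace n) (x.1 : CSpace n)‖ < β * (1 - ‖(x.2 : CSpace n)‖ ^ 2)} := by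
  refine measurableSet_lt ?_ ?_ <;> refine Continuous.measurable ?_
  · unfold herm; fun_prop
  · fun_prop

theorem measurable_weight (n : ℕ) : Measurable fun z : UBall n =>
    ENNReal.ofReal (((1 - ‖(z : CSpace n)‖ ^ 2) ^ n)⁻¹) := by
  refine ENNReal.measurable_ofReal.comp (Measurable.inv (Continuous.measurable ?_))
  fun_prop

theorem measurableSet_admissibleRegion {n : ℕ} (α : ℝ) (ζ : USphere n) :
    MeasurableSet (admissibleRegion α ζ) := by
  refine measurableSet_lt ?_ ?_ <;> refine Continuous.measurable ?_
  · unfold herm; fun_prop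
  · fun_prop

theorem measurable_tildeMu {n : ℕ} (α : ℝ) (μ : Measure (UBall n)) [IsFiniteMeasure μ] :
    Measurable (tildeMu α μ) := by
  have h : ∀ ζ : USphere n, tildeMu α μ ζ = ∫⁻ z, {x : USphere n × UBall n |
      ‖1 - herm (x.2 : CSpace n) (x.1 : CSpace n)‖ < α / 2 * (1 - ‖(x.2 : CSpace n)‖ ^ 2)}.indicator
      (fun x => ENNReal.ofReal (((1 - ‖(x.2 : CSpace n)‖ ^ 2) ^ n)⁻¹)) (ζ, z) ∂μ := by
    intro ζ
    rw [tildeMu, ← lintegral_indicator (measurableSet_admissibleRegion α ζ)]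
    rfl
  rw [funext h]
  exact (((measurable_weight n).comp measurable_snd).indicator
    (measurableSet_approach n (α / 2))).lintegral_prod_right'

theorem lintegral_mul_tildeMu {n : ℕ} (α : ℝ) (μ : Measure (UBall n)) [IsFiniteMeasure μ]
    {G : USphere n → ℝ≥0∞} (hG : Measurable G) :
    ∫⁻ ζ, G ζ * tildeMu α μ ζ ∂(sphereMeasure n) =
      ∫⁻ z, ENNReal.ofReal (((1 - ‖(z : CSpace n)‖ ^ 2) ^ n)⁻¹) *
        ∫⁻ ζ in koranyiBall (z : CSpace n) (α / 2 * (1 - ‖(z : CSpace n)‖ ^ 2)), G ζ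
          ∂(sphereMeasure n) ∂μ := by
  set F : USphere n → UBall n → ℝ≥0∞ := fun ζ z => {x : USphere n × UBall n |
      ‖1 - herm (x.2 : CSpace n) (x.1 : CSpace n)‖ < α / 2 * (1 - ‖(x.2 : CSpace n)‖ ^ 2)}.indicator
      (fun x => G x.1 * ENNReal.ofReal (((1 - ‖(x.2 : CSpace n)‖ ^ 2) ^ n)⁻¹)) (ζ, z) with hF
  have hFm : Measurable (Function.uncurry F) :=
    ((hG.comp measurable_fst).mul ((measurable_weight n).comp measurable_snd)).indicator
      (measurableSet_approach n (α / 2))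
  have h1 : ∀ ζ, G ζ * tildeMu α μ ζ = ∫⁻ z, F ζ z ∂μ := by
    intro ζ
    rw [tildeMu, ← lintegral_const_mul _ (measurable_weight n),
      ← lintegral_indicator (measurableSet_admissibleRegion α ζ)]
    rfl
  have h2 : ∀ z : UBall n, ∫⁻ ζ, F ζ z ∂(sphereMeasure n) =
      ENNReal.ofReal (((1 - ‖(z : CSpace n)‖ ^ 2) ^ n)⁻¹) *
        ∫⁻ ζ in koranyiBall (z : CSpace n) (α / 2 * (1 - ‖(z : CSpace n)‖ ^ 2)), G ζ
          ∂(sphereMeasure n) := by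
    intro z
    rw [← lintegral_const_mul _ hG, ← lintegral_indicator (isOpen_koranyiBall _ _).measurableSet]
    refine lintegral_congr fun ζ => ?_
    simp_rw [mul_comm _ (G _)]
    rfl
  simp_rw [h1]
  rw [lintegral_lintegral_swap hFm.aemeasurable]
  simp_rw [h2]

theorem weight_mul_cancel {n : ℕ} (z : UBall n) :
    ENNReal.ofReal (((1 - ‖(z : CSpace n)‖ ^ 2) ^ n)⁻¹) *
      ENNReal.ofReal ((1 - ‖(z : CSpace n)‖ ^ 2) ^ n) = 1 := by
  have h := pow_pos (one_sub_norm_sq_pos z) n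
  rw [← ENNReal.ofReal_mul (by positivity), inv_mul_cancel₀ h.ne', ENNReal.ofReal_one]

/-! ### Sufficiency away from the origin -/

/-- The embedding inequality for the part of the measure away from the origin. -/
theorem exists_lintegral_le_eLpNorm_tildeMu {n : ℕ} (hn : 1 ≤ n) {p s α ρ : ℝ} (hp : 1 < p)
    (hs : 0 < s) (hsp : s < p) (hα : 1 < α) (hρ0 : 0 ≤ ρ) (hρ : 2 / α - 1 < ρ) :
    ∃ C : ℝ≥0, ∀ μ : Measure (UBall n), IsFiniteMeasure μ → ∀ φ : USphere n → ℂ,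
      MemLp φ (ENNReal.ofReal p) (sphereMeasure n) →
      ∫⁻ z in {z : UBall n | ‖(z : CSpace n)‖ < ρ}ᶜ, ‖invPoissonIntegral φ z‖ₑ ^ s ∂μ ≤
        C * eLpNorm (tildeMu α μ) (ENNReal.ofReal (p / (p - s))) (sphereMeasure n) *
          eLpNorm φ (ENNReal.ofReal p) (sphereMeasure n) ^ s := by
  have hp0 : 0 < p := by linarith
  have hps : 0 < p - s := by linarith
  obtain ⟨C₁, hC₁⟩ := exists_lPoisson_le_koranyiMaximal hn (β := α / 2) (by linarith)
  obtain ⟨c, hc0, hc⟩ := exists_le_sphereMeasure_shadow hn hρ0 (β := α / 2) (by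
    rw [div_lt_div_iff₀ (by linarith) two_pos]
    rw [sub_lt_iff_lt_add, div_lt_iff₀ (by linarith)] at hρ
    linarith)
  obtain ⟨C₂, hC₂⟩ := exists_koranyiMaximal_strong_type hn hp
  have hc0' : (c : ℝ≥0∞) ≠ 0 := by exact_mod_cast hc0.ne'
  set D : ℝ≥0∞ := (c : ℝ≥0∞)⁻¹ * (C₁ : ℝ≥0∞) ^ s with hD
  have hD1 : D ≠ ∞ := ENNReal.mul_ne_top (ENNReal.inv_ne_top.2 hc0')
    (ENNReal.rpow_ne_top_of_nonneg hs.le ENNReal.coe_ne_top)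
  have hE1 : D * (C₂ : ℝ≥0∞) ^ (s / p) ≠ ∞ := ENNReal.mul_ne_top hD1
    (ENNReal.rpow_ne_top_of_nonneg (by positivity) ENNReal.coe_ne_top)
  refine ⟨(D * (C₂ : ℝ≥0∞) ^ (s / p)).toNNReal, fun μ hμ φ hφ => ?_⟩
  rw [ENNReal.coe_toNNReal hE1]
  -- φ is only a.e. measurable; a measurable representative of |φ| has the same Poisson integral and
  -- makes its maximal function measurable.
  have hφe : AEMeasurable (fun ω => ‖φ ω‖ₑ) (sphereMeasure n) := hφ.1.enorm
  set f : USphere n → ℝ≥0∞ := hφe.mk with hf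
  have hfm : Measurable f := hφe.measurable_mk
  have hfe : (fun ω => ‖φ ω‖ₑ) =ᵐ[sphereMeasure n] f := hφe.ae_eq_mk
  have hu : ∀ z, ‖invPoissonIntegral φ z‖ₑ ≤ lPoisson f z := fun z =>
    (enorm_invPoissonIntegral_le φ z).trans (le_of_eq (lintegral_congr_ae (by
      filter_upwards [hfe] with ω hω
      rw [hω])))
  have hMm := measurable_koranyiMaximal hfm
  have hpt : ∀ z : UBall n, ρ ≤ ‖(z : CSpace n)‖ → ‖invPoissonIntegral φ z‖ₑ ^ s ≤
      D * (ENNReal.ofReal (((1 - ‖(z : CSpace n)‖ ^ 2) ^ n)⁻¹) *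
        ∫⁻ ζ in koranyiBall (z : CSpace n) (α / 2 * (1 - ‖(z : CSpace n)‖ ^ 2)),
          koranyiMaximal f ζ ^ s ∂(sphereMeasure n)) := by
    intro z hz
    set w := ENNReal.ofReal (((1 - ‖(z : CSpace n)‖ ^ 2) ^ n)⁻¹) with hw
    set Q := koranyiBall (z : CSpace n) (α / 2 * (1 - ‖(z : CSpace n)‖ ^ 2)) with hQ
    have h1 : lPoisson f z ^ s * sphereMeasure n Q ≤
        (C₁ : ℝ≥0∞) ^ s * ∫⁻ ζ in Q, koranyiMaximal f ζ ^ s ∂(sphereMeasure n) := by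
      rw [← setLIntegral_const, ← lintegral_const_mul _ (hMm.pow_const _)]
      refine setLIntegral_mono ((hMm.pow_const _).const_mul _) fun ζ hζ => ?_
      rw [← ENNReal.mul_rpow_of_nonneg _ _ hs.le]
      exact ENNReal.rpow_le_rpow (hC₁ f hfm z ζ hζ) hs.le
    calc ‖invPoissonIntegral φ z‖ₑ ^ s ≤ lPoisson f z ^ s := ENNReal.rpow_le_rpow (hu z) hs.le
      _ = (c : ℝ≥0∞)⁻¹ * w * (lPoisson f z ^ s *
          (c * ENNReal.ofReal ((1 - ‖(z : CSpace n)‖ ^ 2) ^ n))) := by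
          calc lPoisson f z ^ s = lPoisson f z ^ s * ((c : ℝ≥0∞)⁻¹ * c) *
                (w * ENNReal.ofReal ((1 - ‖(z : CSpace n)‖ ^ 2) ^ n)) := by
                rw [weight_mul_cancel, ENNReal.inv_mul_cancel hc0' ENNReal.coe_ne_top, mul_one,
                  mul_one]
            _ = _ := by ring
      _ ≤ (c : ℝ≥0∞)⁻¹ * w * ((C₁ : ℝ≥0∞) ^ s *
          ∫⁻ ζ in Q, koranyiMaximal f ζ ^ s ∂(sphereMeasure n)) :=
          mul_le_mul_right ((mul_le_mul_right (hc z hz) _).trans h1) _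
      _ = _ := by rw [hD]; ring
  have hset : MeasurableSet {z : UBall n | ‖(z : CSpace n)‖ < ρ}ᶜ :=
    (measurableSet_lt (Continuous.measurable (by fun_prop)) measurable_const).compl
  have hconj : (p / s).HolderConjugate (p / (p - s)) := by
    rw [Real.holderConjugate_iff]
    refine ⟨(one_lt_div hs).2 hsp, ?_⟩
    field_simp; ring
  have hinner : Measurable fun z : UBall n => ENNReal.ofReal (((1 - ‖(z : CSpace n)‖ ^ 2) ^ n)⁻¹) *
      ∫⁻ ζ in koranyiBall (z : CSpace n) (α / 2 * (1 - ‖(z : CSpace n)‖ ^ 2)),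
        koranyiMaximal f ζ ^ s ∂(sphereMeasure n) := by
    refine (measurable_weight n).mul ?_
    simp_rw [← lintegral_indicator (isOpen_koranyiBall _ _).measurableSet]
    exact (((hMm.pow_const s).comp measurable_fst).indicator
      (measurableSet_approach n (α / 2))).lintegral_prod_left'
  calc ∫⁻ z in {z : UBall n | ‖(z : CSpace n)‖ < ρ}ᶜ, ‖invPoissonIntegral φ z‖ₑ ^ s ∂μ
      ≤ ∫⁻ z in {z : UBall n | ‖(z : CSpace n)‖ < ρ}ᶜ,
          D * (ENNReal.ofReal (((1 - ‖(z : CSpace n)‖ ^ 2) ^ n)⁻¹) *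
          ∫⁻ ζ in koranyiBall (z : CSpace n) (α / 2 * (1 - ‖(z : CSpace n)‖ ^ 2)),
            koranyiMaximal f ζ ^ s ∂(sphereMeasure n)) ∂μ :=
        setLIntegral_mono (hinner.const_mul _) fun z hz => hpt z (not_lt.1 hz)
    _ ≤ ∫⁻ z, D * (ENNReal.ofReal (((1 - ‖(z : CSpace n)‖ ^ 2) ^ n)⁻¹) *
          ∫⁻ ζ in koranyiBall (z : CSpace n) (α / 2 * (1 - ‖(z : CSpace n)‖ ^ 2)),
            koranyiMaximal f ζ ^ s ∂(sphereMeasure n)) ∂μ := setLIntegral_le_lintegral _ _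
    _ = D * ∫⁻ ζ, koranyiMaximal f ζ ^ s * tildeMu α μ ζ ∂(sphereMeasure n) := by
        rw [lintegral_const_mul _ hinner, lintegral_mul_tildeMu α μ (hMm.pow_const s)]
    _ ≤ D * ((∫⁻ ζ, (koranyiMaximal f ζ ^ s) ^ (p / s) ∂(sphereMeasure n)) ^ (1 / (p / s)) *
          (∫⁻ ζ, tildeMu α μ ζ ^ (p / (p - s)) ∂(sphereMeasure n)) ^ (1 / (p / (p - s)))) := by
        gcongr
        exact ENNReal.lintegral_mul_le_Lp_mul_Lq _ hconj (hMm.pow_const s).aemeasurable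
          (measurable_tildeMu α μ).aemeasurable
    _ ≤ D * ((C₂ * ∫⁻ ζ, f ζ ^ p ∂(sphereMeasure n)) ^ (s / p) *
          (∫⁻ ζ, tildeMu α μ ζ ^ (p / (p - s)) ∂(sphereMeasure n)) ^ (1 / (p / (p - s)))) := by
        have hpow : ∀ x : ℝ≥0∞, (x ^ s) ^ (p / s) = x ^ p := fun x => by
          rw [← ENNReal.rpow_mul, mul_div_cancel₀ p hs.ne']
        simp_rw [hpow, one_div_div p s]
        gcongr
        exact hC₂ f hfm
    _ = _ := by
        rw [eLpNorm_ofReal_eq hp0, eLpNorm_ofReal_eq (by positivity)]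
        have h1 : ∫⁻ ζ, f ζ ^ p ∂(sphereMeasure n) = ∫⁻ ζ, ‖φ ζ‖ₑ ^ p ∂(sphereMeasure n) :=
          lintegral_congr_ae (by filter_upwards [hfe] with ω hω; rw [hω])
        simp only [enorm_eq_self]
        rw [h1, ENNReal.mul_rpow_of_nonneg _ _ (by positivity), ← ENNReal.rpow_mul,
          one_div_mul_eq_div]
        ring

/-! ### Necessity -/

/-- The averages of `ψ` over shadows are controlled by the Poisson integral of `(Mψ)^(1/s)`. -/
theorem exists_shadow_average_le_lPoisson {n : ℕ} (hn : 1 ≤ n) {s α : ℝ} (hs : 0 < s)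
    (hα : 1 < α) : ∃ C : ℝ≥0, ∀ ψ : USphere n → ℝ≥0∞, Measurable ψ → ∀ z : UBall n,
      ENNReal.ofReal (((1 - ‖(z : CSpace n)‖ ^ 2) ^ n)⁻¹) *
        ∫⁻ ζ in koranyiBall (z : CSpace n) (α / 2 * (1 - ‖(z : CSpace n)‖ ^ 2)), ψ ζ
          ∂(sphereMeasure n) ≤
      C * lPoisson (fun ζ => koranyiMaximal ψ ζ ^ (1 / s)) z ^ s := by
  -- The enlarged shadow contains the α-shadow, and β > 1 makes its measure at least c δⁿ for every
  -- z, the origin included.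
  set β : ℝ := max (α / 2) 2 with hβ
  have hβ2 : 2 ≤ β := le_max_right _ _
  have hβα : α / 2 ≤ β := le_max_left _ _
  obtain ⟨c, hc0, hc⟩ := exists_le_sphereMeasure_shadow hn le_rfl (β := β) (by norm_num; linarith)
  have hc0' : (c : ℝ≥0∞) ≠ 0 := by exact_mod_cast hc0.ne'
  set e : ℝ≥0∞ := ENNReal.ofReal (β ^ (2 * n))⁻¹ * c with he
  have he0 : e ≠ 0 := mul_ne_zero (ENNReal.ofReal_pos.2 (by positivity)).ne' hc0'
  have he1 : e ≠ ∞ := by finiteness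
  set D : ℝ≥0∞ := ENNReal.ofReal ((16 * β) ^ n) with hD
  have hs' : 0 ≤ 1 / s := by positivity
  set E : ℝ≥0∞ := (e⁻¹ * D ^ (1 / s)) ^ s with hE
  have hE1 : E ≠ ∞ := ENNReal.rpow_ne_top_of_nonneg hs.le (ENNReal.mul_ne_top
    (ENNReal.inv_ne_top.2 he0) (ENNReal.rpow_ne_top_of_nonneg hs' ENNReal.ofReal_ne_top))
  refine ⟨E.toNNReal, fun ψ hψ z => ?_⟩
  rw [ENNReal.coe_toNNReal hE1]
  have hδ := one_sub_norm_sq_pos z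
  have hz : ‖(z : CSpace n)‖ ≤ 1 := (mem_ball_zero_iff.1 z.2).le
  have hwc := weight_mul_cancel z
  have hJ := hc z (norm_nonneg _)
  have hlow := fun ζ => @le_invPoissonKernel n β (by linarith) z ζ
  set δ : ℝ := 1 - ‖(z : CSpace n)‖ ^ 2 with hδd
  set w := ENNReal.ofReal ((δ ^ n)⁻¹) with hw
  set J := koranyiBall (z : CSpace n) (β * δ) with hJd
  set a := w * ∫⁻ ζ in koranyiBall (z : CSpace n) (α / 2 * δ), ψ ζ ∂(sphereMeasure n) with ha
  have hMm := measurable_koranyiMaximal hψ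
  -- Seen from any ζ ∈ J, the shadow lies in a ball of radius 4(β + β)δ; the dyadic rounding of
  -- radii doubles 8β to 16β.
  have h1 : ∀ ζ ∈ J, a ≤ D * koranyiMaximal ψ ζ := by
    intro ζ hζ
    have hsub : koranyiBall (z : CSpace n) (α / 2 * δ) ⊆
        koranyiBall (ζ : CSpace n) (8 * β * δ) := by
      intro ω hω
      have h2 : ‖1 - herm (z : CSpace n) (ζ : CSpace n)‖ < β * δ := hζ
      have h3 : ‖1 - herm (z : CSpace n) (ω : CSpace n)‖ < α / 2 * δ := hω
      have h4 := norm_one_sub_herm_triangle (a := (ζ : CSpace n)) (b := (z : CSpace n))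
        (c := (ω : CSpace n)) (by simp) hz (by simp)
      rw [norm_one_sub_herm_comm (ζ : CSpace n) (z : CSpace n)] at h4
      change ‖1 - herm (ζ : CSpace n) (ω : CSpace n)‖ < _
      have h5 := mul_le_mul_of_nonneg_right hβα hδ.le
      linarith
    have h6 := (lintegral_mono_set (μ := sphereMeasure n) (f := ψ) hsub).trans
      (lintegral_koranyiBall_le ψ ζ (by positivity))
    refine (mul_le_mul_right h6 w).trans (le_of_eq ?_)
    rw [show (2 * (8 * β * δ)) ^ n = (16 * β) ^ n * δ ^ n by rw [← mul_pow]; ring,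
      ENNReal.ofReal_mul (by positivity)]
    calc w * (D * ENNReal.ofReal (δ ^ n) * koranyiMaximal ψ ζ)
        = (w * ENNReal.ofReal (δ ^ n)) * (D * koranyiMaximal ψ ζ) := by ring
      _ = _ := by rw [hwc, one_mul]
  -- The power 1/s is applied to the pointwise bound on J before integrating against the kernel, so
  -- no convexity is needed and every s > 0 is allowed.
  have h2 : e * a ^ (1 / s) ≤
      D ^ (1 / s) * lPoisson (fun ζ => koranyiMaximal ψ ζ ^ (1 / s)) z := by
    have hPm : Measurable fun ω => ENNReal.ofReal (invPoissonKernel z ω) *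
        koranyiMaximal ψ ω ^ (1 / s) :=
      ((measurable_invPoissonKernel n).comp measurable_prodMk_left).ennreal_ofReal.mul
        (hMm.pow_const _)
    calc e * a ^ (1 / s) = ENNReal.ofReal (β ^ (2 * n) * δ ^ n)⁻¹ * a ^ (1 / s) *
          (c * ENNReal.ofReal (δ ^ n)) := by
          rw [mul_inv, ENNReal.ofReal_mul (by positivity)]
          calc e * a ^ (1 / s) = e * a ^ (1 / s) * (w * ENNReal.ofReal (δ ^ n)) := by
                rw [hwc, mul_one]
            _ = _ := by rw [he]; ring
      _ ≤ ENNReal.ofReal (β ^ (2 * n) * δ ^ n)⁻¹ * a ^ (1 / s) * sphereMeasure n J := by gcongr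
      _ = ∫⁻ ζ in J, ENNReal.ofReal (β ^ (2 * n) * δ ^ n)⁻¹ * a ^ (1 / s) ∂(sphereMeasure n) := by
          rw [setLIntegral_const]
      _ ≤ ∫⁻ ζ in J, D ^ (1 / s) * (ENNReal.ofReal (invPoissonKernel z ζ) *
          koranyiMaximal ψ ζ ^ (1 / s)) ∂(sphereMeasure n) := by
          refine setLIntegral_mono (hPm.const_mul _) fun ζ hζ => ?_
          have h3 : a ^ (1 / s) ≤ D ^ (1 / s) * koranyiMaximal ψ ζ ^ (1 / s) :=
            (ENNReal.rpow_le_rpow (h1 ζ hζ) hs').trans_eq (ENNReal.mul_rpow_of_nonneg _ _ hs')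
          rw [mul_left_comm]
          exact mul_le_mul' (ENNReal.ofReal_le_ofReal (hlow ζ hζ)) h3
      _ ≤ _ := by
          refine (setLIntegral_le_lintegral _ _).trans (le_of_eq ?_)
          rw [lintegral_const_mul _ hPm, lPoisson]
  have h3 : a ^ (1 / s) ≤
      e⁻¹ * D ^ (1 / s) * lPoisson (fun ζ => koranyiMaximal ψ ζ ^ (1 / s)) z := by
    calc a ^ (1 / s) = e⁻¹ * (e * a ^ (1 / s)) := by
          rw [← mul_assoc, ENNReal.inv_mul_cancel he0 he1, one_mul]
      _ ≤ e⁻¹ * (D ^ (1 / s) * lPoisson (fun ζ => koranyiMaximal ψ ζ ^ (1 / s)) z) := by gcongr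
      _ = _ := by ring
  calc a = (a ^ (1 / s)) ^ s := by
        rw [← ENNReal.rpow_mul, one_div, inv_mul_cancel₀ hs.ne', ENNReal.rpow_one]
    _ ≤ _ := ENNReal.rpow_le_rpow h3 hs.le
    _ = _ := ENNReal.mul_rpow_of_nonneg _ _ hs.le

/-- The embedding inequality tested on a nonnegative extended real function. -/
theorem PoissonEmbeddingBound.lintegral_lPoisson_le {n : ℕ} (hn : 1 ≤ n) {p s : ℝ} (hp : 1 < p)
    {μ : Measure (UBall n)} {K : ℝ≥0∞} (hK : PoissonEmbeddingBound p s μ K)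
    {G : USphere n → ℝ≥0∞} (hG : Measurable G) (hGp : ∫⁻ ζ, G ζ ^ p ∂(sphereMeasure n) ≠ ∞) :
    ∫⁻ z, lPoisson G z ^ s ∂μ ≤ K * (∫⁻ ζ, G ζ ^ p ∂(sphereMeasure n)) ^ (s / p) := by
  have hp0 : 0 < p := by linarith
  have := isProbabilityMeasure_sphereMeasure hn
  have hGtop : ∀ᵐ ζ ∂(sphereMeasure n), G ζ ≠ ∞ := by
    filter_upwards [ae_lt_top (hG.pow_const p) hGp] with ζ hζ h
    rw [h, ENNReal.top_rpow_of_pos hp0] at hζ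
    exact lt_irrefl _ hζ
  -- G is finite almost everywhere, so replacing the value ∞ by 0 changes neither its norm nor its
  -- Poisson integral.
  set φ : USphere n → ℂ := fun ζ => ((G ζ).toReal : ℂ) with hφ
  have hnorm : ∀ᵐ ζ ∂(sphereMeasure n), ‖φ ζ‖ₑ = G ζ := by
    filter_upwards [hGtop] with ζ hζ
    rw [← ofReal_norm, hφ, Complex.norm_real, Real.norm_of_nonneg ENNReal.toReal_nonneg,
      ENNReal.ofReal_toReal hζ]
  have hφm : Measurable φ := Complex.measurable_ofReal.comp hG.ennreal_toReal
  have hint : ∫⁻ ζ, ‖φ ζ‖ₑ ^ p ∂(sphereMeasure n) = ∫⁻ ζ, G ζ ^ p ∂(sphereMeasure n) :=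
    lintegral_congr_ae (by filter_upwards [hnorm] with ζ hζ; rw [hζ])
  have hLp : eLpNorm φ (ENNReal.ofReal p) (sphereMeasure n) =
      (∫⁻ ζ, G ζ ^ p ∂(sphereMeasure n)) ^ (1 / p) := by
    rw [eLpNorm_ofReal_eq hp0, hint]
  have hmem : MemLp φ (ENNReal.ofReal p) (sphereMeasure n) :=
    ⟨hφm.aestronglyMeasurable, by
      rw [hLp]; exact (ENNReal.rpow_ne_top_of_nonneg (by positivity) hGp).lt_top⟩
  have hφi : Integrable φ (sphereMeasure n) :=
    hmem.integrable (by simpa using ENNReal.ofReal_le_ofReal hp.le)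
  have hu : ∀ z, lPoisson G z = ‖invPoissonIntegral φ z‖ₑ := by
    intro z
    have hi : Integrable (fun ω => invPoissonKernel z ω * (G ω).toReal) (sphereMeasure n) := by
      have h1 : Integrable (fun ω => (G ω).toReal) (sphereMeasure n) := by
        simpa [hφ] using hφi.re
      refine h1.bdd_mul (c := ((1 - ‖(z : CSpace n)‖) ^ (2 * n))⁻¹)
        ((measurable_invPoissonKernel n).comp measurable_prodMk_left).aestronglyMeasurable
        (Filter.Eventually.of_forall fun ω => ?_)
      rw [Real.norm_of_nonneg (invPoissonKernel_nonneg z ω)]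
      exact invPoissonKernel_le (mem_ball_zero_iff.1 z.2) le_rfl ω
    have hnn : ∀ ω, 0 ≤ invPoissonKernel z ω * (G ω).toReal := fun ω =>
      mul_nonneg (invPoissonKernel_nonneg z ω) ENNReal.toReal_nonneg
    have h2 : invPoissonIntegral φ z =
        ((∫ ω, invPoissonKernel z ω * (G ω).toReal ∂(sphereMeasure n) : ℝ) : ℂ) := by
      rw [← integral_complex_ofReal, invPoissonIntegral]
      simp [hφ]
    rw [h2, ← ofReal_norm, Complex.norm_real, Real.norm_of_nonneg (integral_nonneg hnn),
      ofReal_integral_eq_lintegral_ofReal hi (Filter.Eventually.of_forall hnn), lPoisson]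
    refine lintegral_congr_ae ?_
    filter_upwards [hGtop] with ω hω
    rw [ENNReal.ofReal_mul (invPoissonKernel_nonneg z ω), ENNReal.ofReal_toReal hω]
  simp_rw [hu]
  refine (hK φ hmem).trans (le_of_eq ?_)
  rw [hLp, ← ENNReal.rpow_mul, one_div_mul_eq_div]

/-- Duality between L^{p/s} and L^{p/(p-s)}: the test function (Mψ)^{1/s} has s-th power of its L^p
norm equal to ‖Mψ‖_{p/s}. -/
theorem exists_eLpNorm_tildeMu_le {n : ℕ} (hn : 1 ≤ n) {p s α : ℝ} (hp : 1 < p)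
    (hs : 0 < s) (hsp : s < p) (hα : 1 < α) :
    ∃ C : ℝ≥0, 0 < C ∧ ∀ μ : Measure (UBall n), IsFiniteMeasure μ → ∀ K : ℝ≥0∞,
      PoissonEmbeddingBound p s μ K →
      eLpNorm (tildeMu α μ) (ENNReal.ofReal (p / (p - s))) (sphereMeasure n) ≤ C * K := by
  have := isProbabilityMeasure_sphereMeasure hn
  have hp0 : 0 < p := by linarith
  have hps : 0 < p - s := by linarith
  have hr1 : 1 < p / s := (one_lt_div hs).2 hsp
  obtain ⟨C₁, hC₁⟩ := exists_shadow_average_le_lPoisson hn hs hα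
  obtain ⟨C₂, hC₂⟩ := exists_koranyiMaximal_strong_type hn hr1
  have hconj : (p / s).HolderConjugate (p / (p - s)) := by
    rw [Real.holderConjugate_iff]
    refine ⟨hr1, ?_⟩
    field_simp; ring
  set D : ℝ≥0∞ := C₁ * (C₂ : ℝ≥0∞) ^ (s / p) with hD
  have hD1 : D ≠ ∞ := ENNReal.mul_ne_top ENNReal.coe_ne_top
    (ENNReal.rpow_ne_top_of_nonneg (by positivity) ENNReal.coe_ne_top)
  -- Adding 1 keeps the constant nonzero, so it can be divided out when passing to the infimum over
  -- K.
  refine ⟨D.toNNReal + 1, by positivity, fun μ hμ K hK => ?_⟩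
  rw [eLpNorm_ofReal_eq (by positivity)]
  simp only [enorm_eq_self]
  have hle : D ≤ ((D.toNNReal + 1 : ℝ≥0) : ℝ≥0∞) := by
    push_cast
    rw [ENNReal.coe_toNNReal hD1]
    exact le_self_add
  refine le_trans ?_ (mul_le_mul_left hle K)
  refine lintegral_rpow_le_of_forall_lintegral_mul_le hconj (measurable_tildeMu α μ)
    fun ψ hψ hψp => ?_
  have hMm := measurable_koranyiMaximal hψ
  have hpow : ∀ ζ, (koranyiMaximal ψ ζ ^ (1 / s)) ^ p = koranyiMaximal ψ ζ ^ (p / s) := fun ζ => by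
    rw [← ENNReal.rpow_mul, one_div_mul_eq_div]
  have hMp := hC₂ ψ hψ
  have hMtop : ∫⁻ ζ, (koranyiMaximal ψ ζ ^ (1 / s)) ^ p ∂(sphereMeasure n) ≠ ∞ := by
    simp_rw [hpow]
    exact ne_top_of_le_ne_top (ENNReal.mul_ne_top ENNReal.coe_ne_top hψp) hMp
  have hlP : Measurable fun z => lPoisson (fun ζ => koranyiMaximal ψ ζ ^ (1 / s)) z ^ s :=
    (measurable_lPoisson (hMm.pow_const _)).pow_const _
  calc ∫⁻ ζ, ψ ζ * tildeMu α μ ζ ∂(sphereMeasure n)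
      ≤ ∫⁻ z, C₁ * lPoisson (fun ζ => koranyiMaximal ψ ζ ^ (1 / s)) z ^ s ∂μ := by
        rw [lintegral_mul_tildeMu α μ hψ]
        exact lintegral_mono fun z => hC₁ ψ hψ z
    _ = C₁ * ∫⁻ z, lPoisson (fun ζ => koranyiMaximal ψ ζ ^ (1 / s)) z ^ s ∂μ :=
        lintegral_const_mul _ hlP
    _ ≤ C₁ * (K * (C₂ * ∫⁻ ζ, ψ ζ ^ (p / s) ∂(sphereMeasure n)) ^ (s / p)) := by
        gcongr
        refine (hK.lintegral_lPoisson_le hn hp (hMm.pow_const _) hMtop).trans ?_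
        simp_rw [hpow]
        gcongr
    _ = _ := by
        rw [ENNReal.mul_rpow_of_nonneg _ _ (by positivity), one_div_div, hD]
        ring

/-! ### The part near the origin, and the conclusion -/

/-- The embedding inequality for the part of the measure near the origin. -/
theorem exists_lintegral_near_zero_le {n : ℕ} (hn : 1 ≤ n) {p s ρ : ℝ} (hp : 1 < p)
    (hs : 0 < s) (hρ : ρ < 1) (μ : Measure (UBall n)) [IsFiniteMeasure μ] :
    ∃ C : ℝ≥0, ∀ φ : USphere n → ℂ, MemLp φ (ENNReal.ofReal p) (sphereMeasure n) →
      ∫⁻ z in {z : UBall n | ‖(z : CSpace n)‖ < ρ}, ‖invPoissonIntegral φ z‖ₑ ^ s ∂μ ≤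
        C * eLpNorm φ (ENNReal.ofReal p) (sphereMeasure n) ^ s := by
  have := isProbabilityMeasure_sphereMeasure hn
  set A : ℝ≥0∞ := ENNReal.ofReal ((1 - ρ) ^ (2 * n))⁻¹ with hA
  -- The constant involves the total mass of μ, so it serves the qualitative statement (i) only.
  have hD1 : A ^ s * μ Set.univ ≠ ∞ := ENNReal.mul_ne_top
    (ENNReal.rpow_ne_top_of_nonneg hs.le ENNReal.ofReal_ne_top) (measure_ne_top _ _)
  refine ⟨(A ^ s * μ Set.univ).toNNReal, fun φ hφ => ?_⟩
  rw [ENNReal.coe_toNNReal hD1]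
  set N := eLpNorm φ (ENNReal.ofReal p) (sphereMeasure n) with hN
  have hpt : ∀ z : UBall n, ‖(z : CSpace n)‖ < ρ → ‖invPoissonIntegral φ z‖ₑ ≤ A * N := by
    intro z hz
    refine (enorm_invPoissonIntegral_le φ z).trans ?_
    calc lPoisson (fun ω => ‖φ ω‖ₑ) z ≤ ∫⁻ ω, A * ‖φ ω‖ₑ ∂(sphereMeasure n) := by
          refine lintegral_mono fun ω => ?_
          dsimp only
          gcongr
          exact ENNReal.ofReal_le_ofReal (invPoissonKernel_le hρ hz.le ω)
      _ = A * eLpNorm φ 1 (sphereMeasure n) := by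
          rw [lintegral_const_mul' _ _ ENNReal.ofReal_ne_top, eLpNorm_one_eq_lintegral_enorm]
      _ ≤ A * N := by
          gcongr
          exact eLpNorm_le_eLpNorm_of_exponent_le
            (by simpa using ENNReal.ofReal_le_ofReal hp.le) hφ.1
  calc ∫⁻ z in {z : UBall n | ‖(z : CSpace n)‖ < ρ}, ‖invPoissonIntegral φ z‖ₑ ^ s ∂μ
      ≤ ∫⁻ z in {z : UBall n | ‖(z : CSpace n)‖ < ρ}, (A * N) ^ s ∂μ :=
        setLIntegral_mono measurable_const fun z hz =>
          ENNReal.rpow_le_rpow (hpt z hz) hs.le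
    _ ≤ (A * N) ^ s * μ Set.univ := by
        rw [setLIntegral_const]
        gcongr
        exact Set.subset_univ _
    _ = _ := by rw [ENNReal.mul_rpow_of_nonneg _ _ hs.le]; ring

theorem mainTheorem10 (n : ℕ) (hn : 1 ≤ n) (p s α : ℝ) (hp : 1 < p) (hs : 0 < s) (hsp : s < p)
    (hα : 1 < α) :
    (∀ μ : Measure (UBall n), IsFiniteMeasure μ →
      ((∃ K : ℝ≥0, PoissonEmbeddingBound p s μ (K : ℝ≥0∞)) ↔
        MemLp (tildeMu α μ) (ENNReal.ofReal (p / (p - s))) (sphereMeasure n))) ∧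
    (∃ C : ℝ≥0, ∀ μ : Measure (UBall n), IsFiniteMeasure μ →
      eLpNorm (tildeMu α μ) (ENNReal.ofReal (p / (p - s))) (sphereMeasure n)
        ≤ (C : ℝ≥0∞) * poissonEmbeddingConst p s μ) ∧
    (∀ ρ : ℝ, 2 / α - 1 < ρ →
      ∃ C : ℝ≥0, ∀ μ : Measure (UBall n), IsFiniteMeasure μ →
        μ {z : UBall n | ‖(z : CSpace n)‖ < ρ} = 0 →
        poissonEmbeddingConst p s μ
          ≤ (C : ℝ≥0∞) *
            eLpNorm (tildeMu α μ) (ENNReal.ofReal (p / (p - s))) (sphereMeasure n)) := by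
  obtain ⟨C₀, hC₀, hnec⟩ := exists_eLpNorm_tildeMu_le hn hp hs hsp hα
  have hmeas : ∀ ρ : ℝ, MeasurableSet {z : UBall n | ‖(z : CSpace n)‖ < ρ} := fun ρ =>
    measurableSet_lt (Continuous.measurable (by fun_prop)) measurable_const
  refine ⟨fun μ hμ => ⟨?_, fun h => ?_⟩, ⟨C₀, fun μ hμ => ?_⟩, fun ρ hρ => ?_⟩
  · rintro ⟨K, hK⟩
    exact ⟨(measurable_tildeMu α μ).aestronglyMeasurable, (hnec μ hμ K hK).trans_lt
      (ENNReal.mul_lt_top ENNReal.coe_lt_top ENNReal.coe_lt_top)⟩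
  · have hα1 : 2 / α - 1 < 1 := by
      rw [sub_lt_iff_lt_add, div_lt_iff₀ (by linarith)]; linarith
    -- Since 2/α - 1 < 1, some radius ρ < 1 separates a core with bounded kernel from an outer
    -- region with large shadows.
    obtain ⟨ρ, hρ, hρ1⟩ := exists_between (max_lt zero_lt_one hα1)
    obtain ⟨C₁, hC₁⟩ := exists_lintegral_le_eLpNorm_tildeMu hn hp hs hsp hα
      ((le_max_left _ _).trans hρ.le) ((le_max_right _ _).trans_lt hρ)
    obtain ⟨C₂, hC₂⟩ := exists_lintegral_near_zero_le hn hp hs hρ1 μ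
    have hT := h.2.ne
    refine ⟨C₂ + C₁ * (eLpNorm (tildeMu α μ) (ENNReal.ofReal (p / (p - s)))
      (sphereMeasure n)).toNNReal, fun φ hφ => ?_⟩
    push_cast
    rw [ENNReal.coe_toNNReal hT, ← lintegral_add_compl _ (hmeas ρ), add_mul]
    exact add_le_add (hC₂ φ hφ) (hC₁ μ hμ φ hφ)
  · rw [← ENNReal.div_le_iff' (by exact_mod_cast hC₀.ne') ENNReal.coe_ne_top]
    refine le_sInf fun K hK => ?_
    rw [ENNReal.div_le_iff' (by exact_mod_cast hC₀.ne') ENNReal.coe_ne_top]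
    exact hnec μ hμ K hK
  · rcases le_or_gt 0 ρ with h0 | h0
    · obtain ⟨C₁, hC₁⟩ := exists_lintegral_le_eLpNorm_tildeMu hn hp hs hsp hα h0 hρ
      refine ⟨C₁, fun μ hμ hμρ => sInf_le fun φ hφ => ?_⟩
      rw [← lintegral_add_compl _ (hmeas ρ), setLIntegral_measure_zero _ _ hμρ, zero_add]
      exact hC₁ μ hμ φ hφ
    -- Here 2/α - 1 < ρ < 0, so radius 0 is admissible and nothing has to be removed.
    · obtain ⟨C₁, hC₁⟩ := exists_lintegral_le_eLpNorm_tildeMu hn hp hs hsp hα le_rfl (hρ.trans h0)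
      refine ⟨C₁, fun μ hμ _ => sInf_le fun φ hφ => ?_⟩
      have hempty : {z : UBall n | ‖(z : CSpace n)‖ < 0} = ∅ := by
        ext z; simp
      have h1 := hC₁ μ hμ φ hφ
      rwa [hempty, Set.compl_empty, Measure.restrict_univ] at h1
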